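/- Let $K\ge 2$, $\alpha>\beta\ge 1$ and $\kappa_1,\kappa_2>0$ be constants, and let $p_n,q_n\in[0,1]$ satisfy $p_n>q_n$, $p_n\to 0$ and $p_n\asymp q_n$ as $n\to\infty$. For a label vector $Z\in[K]^n$ and $a\ge 1$ let $$S_a=\Big\{Z\in[K]^n:\ \frac{n}{aK}\le \#\{i:Z_i=k\}\le \frac{an}{K}\ \text{ for all }k\in[K]\Big\},\qquad \Gamma(Z)=\{\sigma\circ Z:\sigma\text{ a permutation of }[K]\}.$$ Data: for a true label vector $Z^*\in S_\beta$, the adjacency matrix $A$ of an undirected graph without loops on $[n]$ has independent entries $A_{ij}\sim\mathrm{Bernoulli}(P_{ij})$, $i<j$, with $P_{ij}=p_n$ if $Z^*_i=Z^*_j$ and $P_{ij}=q_n$ otherwise; $\mathbb E_{Z^*}$ is the expectation under this law. Bayesian model: $Z$ is uniform on $S_\alpha$; independently, the entries $B_{ab}=B_{ba}$, $1\le a\le b\le K$, are i.i.d. $\mathrm{Beta}(\kappa_1,\kappa_2)$; and $p(A\mid Z,B)=\prod_{i<j}B_{Z_iZ_j}^{A_{ij}}(1-B_{Z_iZ_j})^{1-A_{ij}}$.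 Let $\Pi(\cdot\mid A)$ be the resulting posterior distribution of $Z$. Put $I_n=-2\log\big(\sqrt{p_nq_n}+\sqrt{(1-p_n)(1-q_n)}\big)$, and let $\bar n=n/2$ if $K=2$ and $\bar n=n/(K\beta)$ if $K>2$. Suppose that $$\liminf_{n\to\infty}\frac{\bar n I_n}{\log n}>1 .$$ Then there is a positive sequence $\eta_n\to 0$ such that, for all sufficiently large $n$ and all $Z^*\in S_\beta$, $$\mathbb E_{Z^*}\big[\Pi(Z\in\Gamma(Z^*)\mid A)\big]\ \ge\ 1-n\exp\big(-(1-\eta_n)\bar n I_n\big),$$ and the right-hand side is $1-o(1)$, that is, it tends to $1$ as $n\to\infty$. -/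

import Mathlib

open MeasureTheory ProbabilityTheory Filter Topology Asymptotics

namespace SBM

noncomputable section

open scoped Classical

/-- The likelihood `p(A | Z, B) = ∏_{i<j} B_{Z_i Z_j}^{A_ij} (1 - B_{Z_i Z_j})^{1 - A_ij}` of the
stochastic block model. The undirected, loop-free network `A` is a simple graph on `n` nodes, and
the symmetric connectivity matrix `B` is indexed by unordered pairs of communities (a pair may
consist of twice the same community), so that it has `K (K + 1) / 2` free entries. -/
def likelihood {n K : ℕ} (A : SimpleGraph (Fin n)) (Z : Fin n → Fin K) (B : Sym2 (Fin K) → ℝ) : ℝ :=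
  ∏ e : Fin n × Fin n with e.1 < e.2,
    if A.Adj e.1 e.2 then B s(Z e.1, Z e.2) else 1 - B s(Z e.1, Z e.2)

/-- The homogeneous connectivity matrix: `p` within communities, `q` between communities. -/
def homogeneousB (K : ℕ) (p q : ℝ) : Sym2 (Fin K) → ℝ :=
  fun e => if e.IsDiag then p else q

/-- The expectation of `f(A)` when `A` is generated by the homogeneous block model with labels
`Z` and connectivity probabilities `p`, `q`. -/
def expectation {n K : ℕ} (Z : Fin n → Fin K) (p q : ℝ) (f : SimpleGraph (Fin n) → ℝ) : ℝ :=
  ∑ A : SimpleGraph (Fin n), likelihood A Z (homogeneousB K p q) * f A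

/-- The size `n_k(Z)` of community `k`. -/
def communitySize {n K : ℕ} (Z : Fin n → Fin K) (k : Fin K) : ℕ :=
  Finset.card {i : Fin n | Z i = k}

/-- The label assignments all of whose community sizes lie in `[n / (a K), a n / K]`. -/
def balanced (n K : ℕ) (a : ℝ) : Finset (Fin n → Fin K) :=
  {Z | ∀ k, (n : ℝ) / (a * K) ≤ communitySize Z k ∧ (communitySize Z k : ℝ) ≤ a * n / K}

/-- The clustering class `Γ(Z)` of all relabellings `σ ∘ Z` of `Z`. -/
def clusteringClass {n K : ℕ} (Z : Fin n → Fin K) : Finset (Fin n → Fin K) :=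
  {Z' | ∃ σ : Equiv.Perm (Fin K), Z' = σ ∘ Z}

/-- The uniform prior on the balanced label assignments. -/
def labelPrior {n K : ℕ} (α : ℝ) (Z : Fin n → Fin K) : ℝ :=
  if Z ∈ balanced n K α then ((balanced n K α).card : ℝ)⁻¹ else 0

/-- The prior of the connectivity matrix: independent `Beta(κ₁, κ₂)` entries. -/
def connectivityPrior (K : ℕ) (κ₁ κ₂ : ℝ) : Measure (Sym2 (Fin K) → ℝ) :=
  Measure.pi fun _ => betaMeasure κ₁ κ₂

/-- The likelihood of the labels, with the connectivity matrix integrated out. -/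
def marginalLikelihood {n K : ℕ} (κ₁ κ₂ : ℝ) (A : SimpleGraph (Fin n)) (Z : Fin n → Fin K) : ℝ :=
  ∫ B, likelihood A Z B ∂(connectivityPrior K κ₁ κ₂)

/-- The posterior probability `Π(Z | A)` of the label assignment `Z`, by Bayes' formula. -/
def posterior {n K : ℕ} (α κ₁ κ₂ : ℝ) (A : SimpleGraph (Fin n)) (Z : Fin n → Fin K) : ℝ :=
  labelPrior α Z * marginalLikelihood κ₁ κ₂ A Z /
    ∑ Z' : Fin n → Fin K, labelPrior α Z' * marginalLikelihood κ₁ κ₂ A Z'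

/-- The posterior probability of a set of label assignments. -/
def posteriorMass {n K : ℕ} (α κ₁ κ₂ : ℝ) (A : SimpleGraph (Fin n))
    (S : Finset (Fin n → Fin K)) : ℝ :=
  ∑ Z ∈ S, posterior α κ₁ κ₂ A Z

/-- The Rényi divergence of order `1/2` between `Bernoulli(p)` and `Bernoulli(q)`. -/
def renyi (p q : ℝ) : ℝ :=
  -2 * Real.log (√(p * q) + √((1 - p) * (1 - q)))

/-- The effective sample size: `n / 2` for two communities, `n / (K β)` for more than two. -/
def effectiveSize (K : ℕ) (β : ℝ) (n : ℕ) : ℝ :=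
  if K = 2 then (n : ℝ) / 2 else (n : ℝ) / (K * β)

end

end SBM

namespace SBM

noncomputable section

open scoped Classical

/-! ### Sums over graphs -/

/-! Write M(Z) for the marginal likelihood, d for the number of errors of Z against the truth Z₀,
and X for the product of effective size and Rényi divergence I. The prior is uniform on its support,
so the posterior mass of Z is at most both 1 and M(Z)/M(Z₀), hence at most the root of that ratio.
It remains to sum the expected roots (`rootOdds`) over Z outside the class of Z₀. Both M and the
posterior ignore relabelling, so at the price of a factor K! only the representative closest to Z₀
matters.

A general bound comes from the Bhattacharyya affinity. M(Z₀) is at least the true likelihood up to a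
power of n, and the integral in M(Z) is dominated by a sum over polynomially many grid matrices.
Thus the expected root is at most n^C exp(-D) as soon as the Hellinger distance to (Z, B) is at
least D for every B (`exists_isHellingerConstant`). The pairs that tell Z from Z₀ are the flipped
ones. There are at least d(2n̄ - d) of them, each worth about I/2, which gives the exponent dX.

The labels fall into three ranges. Many errors, d > rn: some community of Z mixes two true ones, so
D is of order n²I, that is nX, and beats the K^n labels (`exists_mul_sq_le_hellinger`). At most rn
errors: in each block of Z the flipped pairs are a small minority, so adapting B to them does not
pay, and D ≥ (1 - ε)dX (`le_hellinger_of_close`). The factor n^C is harmless once d exceeds a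
constant, because the sum over Z contributes powers of nK exp(-(1 - ε)X) ≤ n^(-ε/2). Boundedly many
errors: n^C is not affordable. For B within relative error δ of the truth, the likelihood ratio of Z
to Z₀ has a bound independent of B, which leaves the integral and costs no power of n
(`sum_sqrt_setIntegral_nhd_le`). For other B the misfit alone gives D of order X²/p, which absorbs
n^C because p → 0. The choice δ = ε₁I/p makes both halves work (`rootOdds_le_of_near`).

This proves the bound for each fixed ε₀, and a diagonal choice yields the vanishing sequence. -/

/-- The pairs `i < j` of nodes. -/
abbrev nodePairs (n : ℕ) : Finset (Fin n × Fin n) := {e | e.1 < e.2}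

/-- A sum over all graphs of a product over pairs of nodes factorises. -/
theorem sum_graph_prod {n : ℕ} (x y : Fin n × Fin n → ℝ) :
    ∑ A : SimpleGraph (Fin n), ∏ e ∈ nodePairs n, (if A.Adj e.1 e.2 then x e else y e) =
      ∏ e ∈ nodePairs n, (x e + y e) := by
  -- The expanded product is a sum over subsets of `nodePairs n`, and such subsets are exactly the
  -- edge sets of graphs.
  rw [Finset.prod_add]
  refine Finset.sum_bij' (fun A _ => (nodePairs n).filter fun e => A.Adj e.1 e.2)
    (fun t _ => SimpleGraph.fromRel fun i j => (i, j) ∈ t) ?_ ?_ ?_ ?_ ?_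
  · intro A _
    simp [Finset.filter_subset]
  · intro t _
    simp
  · intro A _
    ext i j
    simp only [SimpleGraph.fromRel_adj, Finset.mem_filter, Finset.mem_univ, true_and]
    constructor
    · rintro ⟨_, h | h⟩
      · exact h.2
      · exact h.2.symm
    · intro h
      refine ⟨h.ne, ?_⟩
      rcases lt_or_gt_of_ne h.ne with h' | h'
      · exact Or.inl ⟨h', h⟩
      · exact Or.inr ⟨h', h.symm⟩
  · intro t ht
    ext ⟨i, j⟩
    have hsub := Finset.mem_powerset.1 ht
    simp only [SimpleGraph.fromRel_adj, Finset.mem_filter, Finset.mem_univ, true_and]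
    constructor
    · rintro ⟨hij, _, h | h⟩
      · exact h
      · have := hsub h
        simp only [Finset.mem_filter, Finset.mem_univ, true_and] at this
        exact absurd hij (not_lt.2 this.le)
    · intro h
      have := hsub h
      simp only [Finset.mem_filter, Finset.mem_univ, true_and] at this
      exact ⟨this, this.ne, Or.inl h⟩
  · intro A _
    rw [Finset.prod_ite, Finset.filter_not]

/-! ### The likelihood -/

/-- The label pair of a pair of nodes. -/
abbrev pairLabel {n K : ℕ} (Z : Fin n → Fin K) (e : Fin n × Fin n) : Sym2 (Fin K) :=
  s(Z e.1, Z e.2)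

/-- Connectivity matrices all of whose entries are probabilities. -/
def IsConnectivity {K : ℕ} (B : Sym2 (Fin K) → ℝ) : Prop := ∀ c, 0 ≤ B c ∧ B c ≤ 1

theorem likelihood_eq {n K : ℕ} (A : SimpleGraph (Fin n)) (Z : Fin n → Fin K)
    (B : Sym2 (Fin K) → ℝ) : likelihood A Z B = ∏ e ∈ nodePairs n,
      if A.Adj e.1 e.2 then B (pairLabel Z e) else 1 - B (pairLabel Z e) := rfl

theorem likelihood_nonneg {n K : ℕ} (A : SimpleGraph (Fin n)) (Z : Fin n → Fin K)
    {B : Sym2 (Fin K) → ℝ} (hB : IsConnectivity B) : 0 ≤ likelihood A Z B := by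
  rw [likelihood_eq]
  refine Finset.prod_nonneg fun e _ => ?_
  have := hB (pairLabel Z e)
  split_ifs <;> linarith

theorem likelihood_pos {n K : ℕ} (A : SimpleGraph (Fin n)) (Z : Fin n → Fin K)
    {B : Sym2 (Fin K) → ℝ} (hB : ∀ c, 0 < B c ∧ B c < 1) : 0 < likelihood A Z B := by
  rw [likelihood_eq]
  refine Finset.prod_pos fun e _ => ?_
  have := hB (pairLabel Z e)
  split_ifs <;> linarith

theorem likelihood_le_one {n K : ℕ} (A : SimpleGraph (Fin n)) (Z : Fin n → Fin K)
    {B : Sym2 (Fin K) → ℝ} (hB : IsConnectivity B) : likelihood A Z B ≤ 1 := by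
  rw [likelihood_eq]
  refine Finset.prod_le_one (fun e _ => ?_) fun e _ => ?_
  all_goals
    have := hB (pairLabel Z e)
    split_ifs <;> linarith

theorem sum_likelihood {n K : ℕ} (Z : Fin n → Fin K) (B : Sym2 (Fin K) → ℝ) :
    ∑ A : SimpleGraph (Fin n), likelihood A Z B = 1 := by
  simp only [likelihood_eq]
  rw [sum_graph_prod (fun e => B (pairLabel Z e)) (fun e => 1 - B (pairLabel Z e))]
  simp

theorem continuous_likelihood {n K : ℕ} (A : SimpleGraph (Fin n)) (Z : Fin n → Fin K) :
    Continuous (likelihood A Z) := by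
  unfold likelihood
  refine continuous_finsetProd _ fun e _ => ?_
  split_ifs <;> fun_prop

theorem card_nodePairs_le (n : ℕ) : ((nodePairs n).card : ℝ) ≤ (n : ℝ) ^ 2 / 2 := by
  have h : 2 * (nodePairs n).card ≤ n * n := by
    have h1 : (nodePairs n).card = (({e | e.2 < e.1} : Finset (Fin n × Fin n))).card := by
      refine Finset.card_bij' (fun e _ => e.swap) (fun e _ => e.swap) ?_ ?_ ?_ ?_ <;> simp
    have h2 : Disjoint (nodePairs n) ({e | e.2 < e.1} : Finset (Fin n × Fin n)) := by
      rw [Finset.disjoint_filter]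
      intro e _ h
      exact not_lt.2 h.le
    have h3 := Finset.card_le_univ (nodePairs n ∪ ({e | e.2 < e.1} : Finset (Fin n × Fin n)))
    rw [Finset.card_union_of_disjoint h2, ← h1] at h3
    simp only [Fintype.card_prod, Fintype.card_fin] at h3
    omega
  have h' : (2 : ℝ) * (nodePairs n).card ≤ n * n := by exact_mod_cast h
  nlinarith

/-- Contracting the connectivity matrix by a factor `1 - t` towards another one changes the
likelihood by at most a factor `1 - t |pairs|`. -/
theorem likelihood_mul_le {n K : ℕ} (A : SimpleGraph (Fin n)) (Z : Fin n → Fin K)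
    {B B' : Sym2 (Fin K) → ℝ} (hB : IsConnectivity B) {t : ℝ} (ht1 : t ≤ 1)
    (htn : t * (n : ℝ) ^ 2 ≤ 1)
    (h : ∀ c, (1 - t) * B c ≤ B' c) (h' : ∀ c, (1 - t) * (1 - B c) ≤ 1 - B' c) (ht0 : 0 ≤ t) :
    likelihood A Z B / 2 ≤ likelihood A Z B' := by
  have h1 : (1 - t) ^ (nodePairs n).card * likelihood A Z B ≤ likelihood A Z B' := by
    rw [likelihood_eq, likelihood_eq, ← Finset.prod_const, ← Finset.prod_mul_distrib]
    refine Finset.prod_le_prod (fun e _ => ?_) fun e _ => ?_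
    · have := hB (pairLabel Z e)
      refine mul_nonneg (by linarith) ?_
      split_ifs <;> linarith
    · split_ifs
      · exact h _
      · exact h' _
  -- Bernoulli's inequality: there are at most n²/2 pairs and t n² ≤ 1.
  have h2 : (1 : ℝ) / 2 ≤ (1 - t) ^ (nodePairs n).card := by
    have := one_add_mul_le_pow (a := -t) (by linarith) (nodePairs n).card
    have h3 := mul_le_mul_of_nonneg_left (card_nodePairs_le n) ht0
    rw [← sub_eq_add_neg] at this
    refine le_trans ?_ this
    nlinarith
  have := mul_le_mul_of_nonneg_right h2 (likelihood_nonneg A Z hB)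
  linarith

/-! ### The Bhattacharyya affinity -/

/-- The affinity of two Bernoulli distributions. -/
def affinity (x y : ℝ) : ℝ := √(x * y) + √((1 - x) * (1 - y))

theorem renyi_eq (p q : ℝ) : renyi p q = -2 * Real.log (affinity p q) := rfl

theorem affinity_nonneg (x y : ℝ) : 0 ≤ affinity x y := by unfold affinity; positivity

theorem affinity_comm (x y : ℝ) : affinity x y = affinity y x := by
  unfold affinity; rw [mul_comm x, mul_comm (1 - x)]

theorem affinity_self {x : ℝ} (h0 : 0 ≤ x) (h1 : x ≤ 1) : affinity x x = 1 := by
  unfold affinity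
  rw [Real.sqrt_mul_self h0, Real.sqrt_mul_self (by linarith)]
  ring

/-- One minus the affinity is half the squared distance of the square-root densities. -/
theorem one_sub_affinity {x y : ℝ} (hx0 : 0 ≤ x) (hx1 : x ≤ 1) (hy0 : 0 ≤ y) (hy1 : y ≤ 1) :
    1 - affinity x y = ((√x - √y) ^ 2 + (√(1 - x) - √(1 - y)) ^ 2) / 2 := by
  unfold affinity
  rw [Real.sqrt_mul hx0, Real.sqrt_mul (by linarith)]
  have h1 := Real.sq_sqrt hx0
  have h2 := Real.sq_sqrt hy0
  have h3 := Real.sq_sqrt (show 0 ≤ 1 - x by linarith)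
  have h4 := Real.sq_sqrt (show 0 ≤ 1 - y by linarith)
  linarith

theorem affinity_le_one {x y : ℝ} (hx0 : 0 ≤ x) (hx1 : x ≤ 1) (hy0 : 0 ≤ y) (hy1 : y ≤ 1) :
    affinity x y ≤ 1 := by
  have := one_sub_affinity hx0 hx1 hy0 hy1
  have : 0 ≤ 1 - affinity x y := by rw [this]; positivity
  linarith

/-- Weighted triangle inequality for the squared Hellinger distance. -/
theorem hellinger_triangle {x y z t : ℝ} (hx0 : 0 ≤ x) (hx1 : x ≤ 1) (hy0 : 0 ≤ y) (hy1 : y ≤ 1)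
    (hz0 : 0 ≤ z) (hz1 : z ≤ 1) :
    t * (1 - affinity x y) ≤
      (1 + t) * ((1 - affinity x z) + t * (1 - affinity y z)) := by
  rw [one_sub_affinity hx0 hx1 hy0 hy1, one_sub_affinity hx0 hx1 hz0 hz1,
    one_sub_affinity hy0 hy1 hz0 hz1]
  have key : ∀ a b c : ℝ, t * (a - b) ^ 2 ≤ (1 + t) * ((a - c) ^ 2 + t * (b - c) ^ 2) := by
    intro a b c
    -- The difference of the two sides is exactly this square. After division by t, the distance
    -- from b to c carries a weight close to 1 when t is small.
    nlinarith [sq_nonneg ((a - c) + t * (b - c))]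
  have h1 := key (√x) (√y) (√z)
  have h2 := key (√(1 - x)) (√(1 - y)) (√(1 - z))
  linarith

/-- A relative deviation δ of x from P moves the root by at least δ√P/3. Otherwise √x ≤ 2√P, and |x
- P| = |√P - √x|(√P + √x) would be less than δP. -/
theorem one_sub_affinity_ge {x P δ : ℝ} (hx0 : 0 ≤ x) (hx1 : x ≤ 1) (hP0 : 0 < P) (hP1 : P ≤ 1)
    (hδ0 : 0 ≤ δ) (hδ1 : δ ≤ 1) (h : δ * P ≤ |x - P|) :
    δ ^ 2 * P / 18 ≤ 1 - affinity P x := by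
  rw [one_sub_affinity hP0.le hP1 hx0 hx1]
  have hs : 0 ≤ √x := Real.sqrt_nonneg x
  have hS : 0 < √P := Real.sqrt_pos.2 hP0
  have h1 := Real.sq_sqrt hx0
  have h2 := Real.sq_sqrt hP0.le
  have key : δ * √P / 3 ≤ |√P - √x| := by
    by_contra hc
    push Not at hc
    have hc' := abs_lt.1 hc
    have hs2 : √x ≤ 2 * √P := by nlinarith
    have hx : |x - P| = |√P - √x| * (√P + √x) := by
      rw [← abs_of_nonneg (show 0 ≤ √P + √x by positivity), ← abs_mul, abs_sub_comm]
      congr 1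
      nlinarith
    have : |x - P| < δ * P := by
      rw [hx]
      have h4 : |√P - √x| * (√P + √x) < δ * √P / 3 * (√P + √x) := by
        apply mul_lt_mul_of_pos_right hc; positivity
      have h5 : δ * √P / 3 * (√P + √x) ≤ δ * √P / 3 * (3 * √P) := by
        apply mul_le_mul_of_nonneg_left (by linarith); positivity
      nlinarith
    linarith
  have h6 : (δ * √P / 3) ^ 2 ≤ (√P - √x) ^ 2 := by
    rw [← sq_abs (√P - √x)]
    exact pow_le_pow_left₀ (by positivity) key 2
  have h7 : (δ * √P / 3) ^ 2 = δ ^ 2 * P / 9 := by rw [div_pow, mul_pow, h2]; norm_num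
  nlinarith [sq_nonneg (√(1 - P) - √(1 - x))]

/-- The total squared Hellinger distance between the pairwise edge distributions. -/
def hellinger {n K : ℕ} (Z₀ Z : Fin n → Fin K) (B₀ B : Sym2 (Fin K) → ℝ) : ℝ :=
  ∑ e ∈ nodePairs n, (1 - affinity (B₀ (pairLabel Z₀ e)) (B (pairLabel Z e)))

/-- Affinities of product measures multiply, and each factor x is at most exp(-(1 - x)). -/
theorem sum_sqrt_likelihood_le {n K : ℕ} (Z₀ Z : Fin n → Fin K) {B₀ B : Sym2 (Fin K) → ℝ}
    (h₀ : IsConnectivity B₀) (hB : IsConnectivity B) :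
    ∑ A : SimpleGraph (Fin n), √(likelihood A Z₀ B₀ * likelihood A Z B) ≤
      Real.exp (-hellinger Z₀ Z B₀ B) := by
  have h : ∀ A : SimpleGraph (Fin n), √(likelihood A Z₀ B₀ * likelihood A Z B) =
      ∏ e ∈ nodePairs n, if A.Adj e.1 e.2 then √(B₀ (pairLabel Z₀ e) * B (pairLabel Z e))
        else √((1 - B₀ (pairLabel Z₀ e)) * (1 - B (pairLabel Z e))) := by
    intro A
    rw [likelihood_eq, likelihood_eq, ← Finset.prod_mul_distrib, Real.sqrt_prod]
    · refine Finset.prod_congr rfl fun e _ => ?_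
      split_ifs <;> rfl
    · intro e _
      have h1 := h₀ (pairLabel Z₀ e)
      have h2 := hB (pairLabel Z e)
      split_ifs <;> exact mul_nonneg (by linarith) (by linarith)
  simp only [h]
  rw [sum_graph_prod (fun e => √(B₀ (pairLabel Z₀ e) * B (pairLabel Z e)))
    (fun e => √((1 - B₀ (pairLabel Z₀ e)) * (1 - B (pairLabel Z e)))), hellinger,
    ← Finset.sum_neg_distrib, Real.exp_sum]
  refine Finset.prod_le_prod (fun e _ => affinity_nonneg _ _) fun e _ => ?_
  have := Real.add_one_le_exp (-(1 - affinity (B₀ (pairLabel Z₀ e)) (B (pairLabel Z e))))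
  unfold affinity at *
  linarith

/-! ### The prior of the connectivity matrix -/

theorem isProbabilityMeasure_connectivityPrior (K : ℕ) {κ₁ κ₂ : ℝ} (h₁ : 0 < κ₁) (h₂ : 0 < κ₂) :
    IsProbabilityMeasure (connectivityPrior K κ₁ κ₂) := by
  have := isProbabilityMeasureBeta h₁ h₂
  unfold connectivityPrior
  infer_instance

theorem ae_betaMeasure_mem_Ioo (κ₁ κ₂ : ℝ) : ∀ᵐ x ∂betaMeasure κ₁ κ₂, 0 < x ∧ x < 1 := by
  unfold betaMeasure
  rw [ae_withDensity_iff (by unfold betaPDF; fun_prop)]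
  refine ae_of_all _ fun x hx => ?_
  by_contra h
  apply hx
  unfold betaPDF betaPDFReal
  simp [h]

theorem ae_connectivityPrior (K : ℕ) {κ₁ κ₂ : ℝ} (h₁ : 0 < κ₁) (h₂ : 0 < κ₂) :
    ∀ᵐ B ∂connectivityPrior K κ₁ κ₂, IsConnectivity B := by
  have := isProbabilityMeasureBeta h₁ h₂
  unfold connectivityPrior IsConnectivity
  refine eventually_all.2 fun c => ?_
  have := (Measure.tendsto_eval_ae_ae (μ := fun _ : Sym2 (Fin K) => betaMeasure κ₁ κ₂)
    (i := c)).eventually (ae_betaMeasure_mem_Ioo κ₁ κ₂)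
  filter_upwards [this] with B hB
  exact ⟨hB.1.le, hB.2.le⟩

theorem integrable_likelihood {n K : ℕ} {κ₁ κ₂ : ℝ} (h₁ : 0 < κ₁) (h₂ : 0 < κ₂)
    (A : SimpleGraph (Fin n)) (Z : Fin n → Fin K) :
    Integrable (likelihood A Z) (connectivityPrior K κ₁ κ₂) := by
  have := isProbabilityMeasure_connectivityPrior K h₁ h₂
  refine Integrable.of_bound (continuous_likelihood A Z).aestronglyMeasurable 1 ?_
  filter_upwards [ae_connectivityPrior K h₁ h₂] with B hB
  rw [Real.norm_of_nonneg (likelihood_nonneg A Z hB)]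
  exact likelihood_le_one A Z hB

theorem marginalLikelihood_nonneg {n K : ℕ} {κ₁ κ₂ : ℝ} (h₁ : 0 < κ₁) (h₂ : 0 < κ₂)
    (A : SimpleGraph (Fin n)) (Z : Fin n → Fin K) : 0 ≤ marginalLikelihood κ₁ κ₂ A Z := by
  refine integral_nonneg_of_ae ?_
  filter_upwards [ae_connectivityPrior K h₁ h₂] with B hB
  exact likelihood_nonneg A Z hB

/-- The interval consists of values to which `likelihood_mul_le` applies with centre b, and it keeps
distance t/4 from 0 and 1. The density there is bounded below with exponents κ in place of κ - 1,
which is valid whether κ is below or above 1. -/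
theorem betaMeasure_Icc_ge {κ₁ κ₂ : ℝ} (h₁ : 0 < κ₁) (h₂ : 0 < κ₂) {b t : ℝ} (hb0 : 0 ≤ b)
    (hb1 : b ≤ 1) (ht0 : 0 < t) (ht1 : t ≤ 1) :
    t / 2 * ((t / 4) ^ κ₁ * (t / 4) ^ κ₂ / beta κ₁ κ₂) ≤
      (betaMeasure κ₁ κ₂).real (Set.Icc ((1 - t) * b + t / 4) ((1 - t) * b + 3 * t / 4)) := by
  have := isProbabilityMeasureBeta h₁ h₂
  have hβ := beta_pos h₁ h₂
  set J := Set.Icc ((1 - t) * b + t / 4) ((1 - t) * b + 3 * t / 4) with hJ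
  set w : ℝ := (t / 4) ^ κ₁ * (t / 4) ^ κ₂ / beta κ₁ κ₂ with hw
  have hw0 : 0 ≤ w := by positivity
  have hlow : ENNReal.ofReal w * volume J ≤ betaMeasure κ₁ κ₂ J := by
    unfold betaMeasure
    rw [withDensity_apply _ measurableSet_Icc, ← setLIntegral_const]
    refine setLIntegral_mono' measurableSet_Icc fun x hx => ?_
    have hx0 : t / 4 ≤ x := by
      have := hx.1
      nlinarith [mul_nonneg (sub_nonneg.2 ht1) hb0]
    have hx1 : t / 4 ≤ 1 - x := by
      have := hx.2
      nlinarith [mul_nonneg (sub_nonneg.2 ht1) (sub_nonneg.2 hb1)]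
    rw [betaPDF_of_pos_lt_one (by linarith) (by linarith)]
    refine ENNReal.ofReal_le_ofReal ?_
    have key : ∀ (z κ : ℝ), 0 < κ → t / 4 ≤ z → z ≤ 1 → (t / 4) ^ κ ≤ z ^ (κ - 1) := by
      intro z κ hκ hz hz1
      refine (Real.rpow_le_rpow (by positivity) hz hκ.le).trans ?_
      exact Real.rpow_le_rpow_of_exponent_ge (by linarith) hz1 (by linarith)
    have k1 := key x κ₁ h₁ hx0 (by linarith)
    have k2 := key (1 - x) κ₂ h₂ hx1 (by linarith)
    rw [hw, mul_assoc, one_div, div_eq_inv_mul]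
    refine mul_le_mul_of_nonneg_left (mul_le_mul k1 k2 (by positivity) ?_) (by positivity)
    exact Real.rpow_nonneg (by linarith) _
  have hvol : volume J = ENNReal.ofReal (t / 2) := by
    rw [hJ, Real.volume_Icc]
    congr 1; ring
  rw [hvol, ← ENNReal.ofReal_mul hw0] at hlow
  rw [measureReal_def, mul_comm]
  exact (ENNReal.ofReal_le_iff_le_toReal (measure_ne_top _ _)).1 hlow

/-- The marginal likelihood is at least the maximal likelihood, up to a power of `n`. -/
theorem exists_marginalLikelihood_ge (K : ℕ) {κ₁ κ₂ : ℝ} (h₁ : 0 < κ₁) (h₂ : 0 < κ₂) :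
    ∃ C : ℝ, 0 ≤ C ∧ ∀ (n : ℕ), 2 ≤ n → ∀ (A : SimpleGraph (Fin n)) (Z : Fin n → Fin K)
      (B : Sym2 (Fin K) → ℝ), IsConnectivity B →
        Real.exp (-(C * Real.log n)) * likelihood A Z B ≤ marginalLikelihood κ₁ κ₂ A Z := by
  have hβ := beta_pos h₁ h₂
  set d := Fintype.card (Sym2 (Fin K)) with hd
  -- the logarithm of the prior mass of a box is affine in `log n`
  set u : ℝ := Real.log 2 + (κ₁ + κ₂) * Real.log 4 + Real.log (beta κ₁ κ₂) with hu
  set v : ℝ := 2 + 2 * (κ₁ + κ₂) with hv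
  -- As log n ≥ log 2, the summand 1 absorbs the factor 1/2 from `likelihood_mul_le`, and d|u|/log 2
  -- absorbs the constant part of the log-mass.
  refine ⟨(1 + d * |u| / Real.log 2) + d * v, by positivity, ?_⟩
  intro n hn A Z B hB
  have hprob := isProbabilityMeasureBeta h₁ h₂
  have hπ := isProbabilityMeasure_connectivityPrior K h₁ h₂
  have hn2 : (2 : ℝ) ≤ n := by exact_mod_cast hn
  have hn0 : (0 : ℝ) < n := by linarith
  -- At accuracy n⁻² the likelihood changes at most by the factor 2, while the box still has
  -- polynomial prior mass.
  set t : ℝ := 1 / (n : ℝ) ^ 2 with ht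
  have ht0 : 0 < t := by positivity
  have ht1 : t ≤ 1 := by
    rw [ht, div_le_one (by positivity)]; nlinarith
  have htn : t * (n : ℝ) ^ 2 = 1 := by rw [ht]; field_simp
  set J : Sym2 (Fin K) → Set ℝ := fun c =>
    Set.Icc ((1 - t) * B c + t / 4) ((1 - t) * B c + 3 * t / 4) with hJ
  set w : ℝ := t / 2 * ((t / 4) ^ κ₁ * (t / 4) ^ κ₂ / beta κ₁ κ₂) with hw
  have hw0 : 0 < w := by positivity
  have hmeas : MeasurableSet (Set.univ.pi J) :=
    MeasurableSet.univ_pi fun c => measurableSet_Icc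
  have hmass : w ^ d ≤ (connectivityPrior K κ₁ κ₂).real (Set.univ.pi J) := by
    unfold connectivityPrior
    rw [measureReal_def, Measure.pi_pi, ENNReal.toReal_prod, hd, ← Finset.card_univ,
      ← Finset.prod_const]
    exact Finset.prod_le_prod (fun _ _ => hw0.le) fun c _ =>
      betaMeasure_Icc_ge h₁ h₂ (hB c).1 (hB c).2 ht0 ht1
  have hL := likelihood_nonneg A Z hB
  have hle_int : likelihood A Z B / 2 * (connectivityPrior K κ₁ κ₂).real (Set.univ.pi J) ≤
      marginalLikelihood κ₁ κ₂ A Z := by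
    have hi := integrable_likelihood h₁ h₂ A Z
    have e1 : ∫ _ in Set.univ.pi J, likelihood A Z B / 2 ∂connectivityPrior K κ₁ κ₂ =
        likelihood A Z B / 2 * (connectivityPrior K κ₁ κ₂).real (Set.univ.pi J) := by
      rw [setIntegral_const, smul_eq_mul, mul_comm]
    rw [← e1]
    refine (setIntegral_mono_on (integrable_const _).integrableOn hi.integrableOn hmeas
      fun B' hB' => ?_).trans (setIntegral_le_integral hi ?_)
    · refine likelihood_mul_le A Z hB ht1 htn.le (fun c => ?_) (fun c => ?_) ht0.le
      · have := (hB' c (Set.mem_univ c)).1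
        linarith
      · have := (hB' c (Set.mem_univ c)).2
        nlinarith
    · filter_upwards [ae_connectivityPrior K h₁ h₂] with B hB
      exact likelihood_nonneg A Z hB
  refine le_trans ?_ hle_int
  have hlog2 : 0 < Real.log 2 := Real.log_pos (by norm_num)
  have hlogn : Real.log 2 ≤ Real.log n := Real.log_le_log (by norm_num) hn2
  have hlogt : Real.log t = -(2 * Real.log n) := by
    rw [ht, one_div, Real.log_inv, Real.log_pow]; norm_num
  have hlogw : Real.log w = -(u + v * Real.log n) := by
    rw [hw, Real.log_mul (by positivity) (by positivity),
      Real.log_div ht0.ne' (show (2 : ℝ) ≠ 0 by norm_num), Real.log_div (by positivity) hβ.ne', Real.log_mul (by positivity) (by positivity),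
      Real.log_rpow (by positivity), Real.log_rpow (by positivity),
      Real.log_div ht0.ne' (show (4 : ℝ) ≠ 0 by norm_num), hlogt]
    ring
  have hexp : Real.exp (-(((1 + d * |u| / Real.log 2) + d * v) * Real.log n)) ≤ w ^ d / 2 := by
    rw [← Real.le_log_iff_exp_le (by positivity), Real.log_div (by positivity) (by norm_num),
      Real.log_pow, hlogw]
    have e1 : d * |u| ≤ d * |u| / Real.log 2 * Real.log n := by
      rw [div_mul_eq_mul_div, le_div_iff₀ hlog2]
      exact mul_le_mul_of_nonneg_left hlogn (by positivity)
    have e2 : (d : ℝ) * u ≤ d * |u| := mul_le_mul_of_nonneg_left (le_abs_self u) (by positivity)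
    nlinarith
  calc _ ≤ w ^ d / 2 * likelihood A Z B := mul_le_mul_of_nonneg_right hexp hL
    _ = likelihood A Z B / 2 * w ^ d := by ring
    _ ≤ _ := mul_le_mul_of_nonneg_left hmass (by linarith)

theorem marginalLikelihood_pos {n K : ℕ} {κ₁ κ₂ : ℝ} (h₁ : 0 < κ₁) (h₂ : 0 < κ₂) (hn : 2 ≤ n)
    (A : SimpleGraph (Fin n)) (Z : Fin n → Fin K) : 0 < marginalLikelihood κ₁ κ₂ A Z := by
  obtain ⟨C, _, hC⟩ := exists_marginalLikelihood_ge K h₁ h₂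
  refine lt_of_lt_of_le ?_ (hC n hn A Z (fun _ => 1 / 2) fun _ => by norm_num)
  have := likelihood_pos A Z (B := fun _ => (1 : ℝ) / 2) fun _ => by norm_num
  positivity

/-! ### Invariance under relabelling -/

/-- The permutation of unordered pairs induced by a permutation. -/
def sym2Perm {K : ℕ} (σ : Equiv.Perm (Fin K)) : Equiv.Perm (Sym2 (Fin K)) where
  toFun := Sym2.map σ
  invFun := Sym2.map σ.symm
  left_inv c := by simp [Sym2.map_map]
  right_inv c := by simp [Sym2.map_map]

/-- The marginal likelihood is invariant under relabelling. -/
theorem marginalLikelihood_perm_comp {n K : ℕ} {κ₁ κ₂ : ℝ} (h₁ : 0 < κ₁) (h₂ : 0 < κ₂)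
    (A : SimpleGraph (Fin n)) (σ : Equiv.Perm (Fin K)) (Z : Fin n → Fin K) :
    marginalLikelihood κ₁ κ₂ A (σ ∘ Z) = marginalLikelihood κ₁ κ₂ A Z := by
  have := isProbabilityMeasureBeta h₁ h₂
  -- The entries are i.i.d. under the prior, so permuting the coordinates preserves it.
  have hmp := measurePreserving_piCongrLeft
    (fun _ : Sym2 (Fin K) => betaMeasure κ₁ κ₂) (sym2Perm σ).symm
  have := hmp.integral_comp (MeasurableEquiv.measurableEmbedding _) (likelihood A Z)
  unfold marginalLikelihood connectivityPrior
  rw [← this]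
  refine integral_congr_ae (ae_of_all _ fun B => ?_)
  unfold likelihood
  refine Finset.prod_congr rfl fun e _ => ?_
  have hval : (MeasurableEquiv.piCongrLeft (fun _ : Sym2 (Fin K) => ℝ)
      (sym2Perm σ).symm) B s(Z e.1, Z e.2) = B s((σ ∘ Z) e.1, (σ ∘ Z) e.2) := by
    have := Equiv.piCongrLeft_apply_apply (fun _ : Sym2 (Fin K) => ℝ)
      (sym2Perm σ).symm B s(σ (Z e.1), σ (Z e.2))
    simpa [sym2Perm, MeasurableEquiv.coe_piCongrLeft] using this
  rw [hval]

theorem sqrt_add_le {a b : ℝ} (ha : 0 ≤ a) (hb : 0 ≤ b) : √(a + b) ≤ √a + √b := by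
  refine Real.sqrt_le_iff.2 ⟨by positivity, ?_⟩
  nlinarith [Real.sq_sqrt ha, Real.sq_sqrt hb, mul_nonneg (Real.sqrt_nonneg a) (Real.sqrt_nonneg b)]

/-! ### Discretisation of the connectivity matrix -/

/-- Rounding of a probability to a grid of mesh `1 / N`, slightly contracted to stay in `[0, 1]`. -/
def roundGrid (N : ℕ) (x : ℝ) : ℝ := (1 - 1 / (N : ℝ)) * (⌈N * x⌉₊ / N)

/-- The grid of rounded connectivity matrices. -/
def connectivityGrid (K N : ℕ) : Finset (Sym2 (Fin K) → ℝ) :=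
  Fintype.piFinset fun _ => (Finset.range (N + 1)).image fun j : ℕ => (1 - 1 / (N : ℝ)) * (j / N)

theorem card_connectivityGrid_le (K N : ℕ) :
    (connectivityGrid K N).card ≤ (N + 1) ^ Fintype.card (Sym2 (Fin K)) := by
  unfold connectivityGrid
  rw [Fintype.card_piFinset, Finset.prod_const, Finset.card_univ]
  exact Nat.pow_le_pow_left (Finset.card_image_le.trans (by simp)) _

/-- These are the hypotheses of `likelihood_mul_le` with t = 1/N. Rounding up gives the first, and
the factor 1 - 1/N offsets the overshoot in the second. -/
theorem roundGrid_bounds {N : ℕ} (hN : 1 ≤ N) {x : ℝ} (h0 : 0 ≤ x) :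
    (1 - 1 / (N : ℝ)) * x ≤ roundGrid N x ∧
      (1 - 1 / (N : ℝ)) * (1 - x) ≤ 1 - roundGrid N x := by
  have hN' : (1 : ℝ) ≤ N := by exact_mod_cast hN
  have hN0 : (0 : ℝ) < N := by linarith
  have h1 : 0 ≤ 1 - 1 / (N : ℝ) := by
    rw [sub_nonneg, div_le_one hN0]; exact hN'
  have hc1 := Nat.le_ceil (N * x)
  have hc2 := (Nat.ceil_lt_add_one (show 0 ≤ N * x by positivity)).le
  have e1 : x ≤ (⌈N * x⌉₊ : ℝ) / N := by rw [le_div_iff₀ hN0]; linarith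
  have e2 : (⌈N * x⌉₊ : ℝ) / N ≤ x + 1 / N := by
    rw [div_le_iff₀ hN0, add_mul, div_mul_cancel₀ _ hN0.ne']; linarith
  unfold roundGrid
  refine ⟨mul_le_mul_of_nonneg_left e1 h1, ?_⟩
  have e3 := mul_le_mul_of_nonneg_left e2 h1
  have e4 : 0 ≤ 1 / (N : ℝ) := by positivity
  nlinarith

theorem roundGrid_comp_mem {K N : ℕ} {B : Sym2 (Fin K) → ℝ} (hB : IsConnectivity B) :
    (fun c => roundGrid N (B c)) ∈ connectivityGrid K N := by
  unfold connectivityGrid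
  rw [Fintype.mem_piFinset]
  intro c
  refine Finset.mem_image.2 ⟨⌈N * B c⌉₊, ?_, rfl⟩
  rw [Finset.mem_range, Nat.lt_succ_iff, Nat.ceil_le]
  have := (hB c).2
  have h : (0 : ℝ) ≤ N := by positivity
  nlinarith

/-- The constant `C` controls the polynomial loss in the Hellinger bound for the posterior mass of
labels `Z` and connectivity matrices in `V`, relative to the marginal likelihood of the true
labels `Z₀`. -/
def IsHellingerConstant (K : ℕ) (κ₁ κ₂ C : ℝ) : Prop :=
  ∀ (n : ℕ), 2 ≤ n → ∀ (Z₀ Z : Fin n → Fin K) (B₀ : Sym2 (Fin K) → ℝ),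
    (∀ c, 0 < B₀ c ∧ B₀ c < 1) → ∀ V : Set (Sym2 (Fin K) → ℝ), MeasurableSet V → ∀ D : ℝ,
    (∀ B ∈ V, IsConnectivity B → ∀ B', IsConnectivity B' →
      (∀ c, |B' c - B c| ≤ 1 / (n : ℝ) ^ 2) → D ≤ hellinger Z₀ Z B₀ B') →
    ∑ A : SimpleGraph (Fin n), likelihood A Z₀ B₀ *
      √((∫ B in V, likelihood A Z B ∂connectivityPrior K κ₁ κ₂) /
        marginalLikelihood κ₁ κ₂ A Z₀) ≤ Real.exp (C * Real.log n - D)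

theorem exists_isHellingerConstant (K : ℕ) {κ₁ κ₂ : ℝ} (h₁ : 0 < κ₁) (h₂ : 0 < κ₂) :
    ∃ C : ℝ, 0 ≤ C ∧ IsHellingerConstant K κ₁ κ₂ C := by
  obtain ⟨C, hC0, hC⟩ := exists_marginalLikelihood_ge K h₁ h₂
  set d := Fintype.card (Sym2 (Fin K)) with hd
  -- The root of 2n^C is at most n^(1 + C/2), and the grid has at most (n² + 1)^d ≤ n^(3d) points.
  refine ⟨1 + C / 2 + 3 * d, by positivity, ?_⟩
  intro n hn Z₀ Z B₀ hB₀ V hV D hD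
  have hπ := isProbabilityMeasure_connectivityPrior K h₁ h₂
  have hB₀' : IsConnectivity B₀ := fun c => ⟨(hB₀ c).1.le, (hB₀ c).2.le⟩
  have hn2 : (2 : ℝ) ≤ n := by exact_mod_cast hn
  have hn0 : (0 : ℝ) < n := by linarith
  have hN : 1 ≤ n ^ 2 := Nat.one_le_pow _ _ (by omega)
  have hcast : ((n ^ 2 : ℕ) : ℝ) = (n : ℝ) ^ 2 := by push_cast; ring
  set t : ℝ := 1 / (n : ℝ) ^ 2 with ht
  have ht0 : 0 < t := by positivity
  have ht1 : t ≤ 1 := by rw [ht, div_le_one (by positivity)]; nlinarith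
  have htn : t * (n : ℝ) ^ 2 = 1 := by rw [ht]; field_simp
  set r : (Sym2 (Fin K) → ℝ) → Sym2 (Fin K) → ℝ := fun B c => roundGrid (n ^ 2) (B c) with hr
  have hround : ∀ B, IsConnectivity B → ∀ c, (1 - t) * B c ≤ r B c ∧
      (1 - t) * (1 - B c) ≤ 1 - r B c := by
    intro B hB c
    have := roundGrid_bounds hN (hB c).1
    rw [hcast] at this
    exact this
  have hrconn : ∀ B, IsConnectivity B → IsConnectivity (r B) := by
    intro B hB c
    have h := hround B hB c
    have h3 := mul_nonneg (sub_nonneg.2 ht1) (hB c).1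
    have h4 := mul_nonneg (sub_nonneg.2 ht1) (sub_nonneg.2 (hB c).2)
    constructor <;> linarith
  -- Only roundings of matrices in V are kept. They may leave V, but by at most n⁻² per entry, which
  -- is why the lower bound D is required on that enlargement.
  set G := (connectivityGrid K (n ^ 2)).filter
    fun B' => ∃ B ∈ V, IsConnectivity B ∧ r B = B' with hG
  have hGconn : ∀ B' ∈ G, IsConnectivity B' := by
    intro B' hB'
    obtain ⟨B, _, hB, rfl⟩ := (Finset.mem_filter.1 hB').2
    exact hrconn B hB
  have hGD : ∀ B' ∈ G, D ≤ hellinger Z₀ Z B₀ B' := by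
    intro B' hB'
    obtain ⟨B, hBV, hB, rfl⟩ := (Finset.mem_filter.1 hB').2
    refine hD B hBV hB _ (hrconn B hB) fun c => ?_
    have h := hround B hB c
    have hBc := hB c
    rw [abs_le]
    constructor <;> nlinarith
  -- the integral is dominated by the sum over the grid
  have hle_int : ∀ A : SimpleGraph (Fin n),
      ∫ B in V, likelihood A Z B ∂connectivityPrior K κ₁ κ₂ ≤
        2 * ∑ B' ∈ G, likelihood A Z B' := by
    intro A
    have hs : 0 ≤ 2 * ∑ B' ∈ G, likelihood A Z B' :=
      mul_nonneg (by norm_num)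
        (Finset.sum_nonneg fun B' hB' => likelihood_nonneg A Z (hGconn B' hB'))
    have hle : ∫ B in V, likelihood A Z B ∂connectivityPrior K κ₁ κ₂ ≤
        ∫ B in V, 2 * ∑ B' ∈ G, likelihood A Z B' ∂connectivityPrior K κ₁ κ₂ := by
      refine setIntegral_mono_on_ae (integrable_likelihood h₁ h₂ A Z).integrableOn
        (integrable_const _).integrableOn hV ?_
      filter_upwards [ae_connectivityPrior K h₁ h₂] with B hB hBV
      have e1 := likelihood_mul_le A Z hB ht1 htn.le (fun c => (hround B hB c).1)
        (fun c => (hround B hB c).2) ht0.le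
      have hmem : r B ∈ G := Finset.mem_filter.2 ⟨roundGrid_comp_mem hB, B, hBV, hB, rfl⟩
      have e2 := Finset.single_le_sum
        (fun B' hB' => likelihood_nonneg A Z (hGconn B' hB')) hmem
      linarith
    refine hle.trans ?_
    rw [setIntegral_const, smul_eq_mul]
    exact mul_le_of_le_one_left hs measureReal_le_one
  set E : ℝ := Real.exp (C * Real.log n) with hE
  have hE0 : 0 < E := Real.exp_pos _
  have hterm : ∀ A : SimpleGraph (Fin n), likelihood A Z₀ B₀ *
        √((∫ B in V, likelihood A Z B ∂connectivityPrior K κ₁ κ₂) /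
          marginalLikelihood κ₁ κ₂ A Z₀) ≤
      √(2 * E) * ∑ B' ∈ G, √(likelihood A Z₀ B₀ * likelihood A Z B') := by
    intro A
    have hL := likelihood_pos A Z₀ hB₀
    set ℓ := likelihood A Z₀ B₀ with hℓ
    have hM : E⁻¹ * ℓ ≤ marginalLikelihood κ₁ κ₂ A Z₀ := by
      rw [hE, ← Real.exp_neg]
      exact hC n hn A Z₀ B₀ hB₀'
    have hS : 0 ≤ ∑ B' ∈ G, likelihood A Z B' :=
      Finset.sum_nonneg fun B' hB' => likelihood_nonneg A Z (hGconn B' hB')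
    have hEl : 0 < E⁻¹ * ℓ := by positivity
    have e1 : (∫ B in V, likelihood A Z B ∂connectivityPrior K κ₁ κ₂) /
        marginalLikelihood κ₁ κ₂ A Z₀ ≤ (2 * ∑ B' ∈ G, likelihood A Z B') / (E⁻¹ * ℓ) :=
      div_le_div₀ (by positivity) (hle_int A) hEl hM
    have e2 : ℓ * √((2 * ∑ B' ∈ G, likelihood A Z B') / (E⁻¹ * ℓ)) =
        √(2 * E) * √(∑ B' ∈ G, ℓ * likelihood A Z B') := by
      have e : (2 * ∑ B' ∈ G, likelihood A Z B') / (E⁻¹ * ℓ) =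
          (2 * E * (ℓ * ∑ B' ∈ G, likelihood A Z B')) / ℓ ^ 2 := by field_simp
      rw [e, Real.sqrt_div (by positivity), Real.sqrt_sq hL.le, mul_div_cancel₀ _ hL.ne',
        ← Finset.mul_sum, Real.sqrt_mul (by positivity)]
    -- Subadditivity of the root reduces the mixture to single matrices, for which the affinity is
    -- explicit.
    have e3 : ∀ s ⊆ G, √(∑ B' ∈ s, ℓ * likelihood A Z B') ≤
        ∑ B' ∈ s, √(ℓ * likelihood A Z B') := by
      intro s
      induction s using Finset.induction_on with
      | empty => simp
      | insert a s ha ih =>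
        intro hs
        have hpos : ∀ B' ∈ insert a s, 0 ≤ ℓ * likelihood A Z B' := fun B' hB' =>
          mul_nonneg hL.le (likelihood_nonneg A Z (hGconn B' (hs hB')))
        rw [Finset.sum_insert ha, Finset.sum_insert ha]
        refine (sqrt_add_le (hpos a (Finset.mem_insert_self a s)) (Finset.sum_nonneg fun B' hB' =>
          hpos B' (Finset.mem_insert_of_mem hB'))).trans ?_
        linarith [ih ((Finset.subset_insert a s).trans hs)]
    calc _ ≤ ℓ * √((2 * ∑ B' ∈ G, likelihood A Z B') / (E⁻¹ * ℓ)) :=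
          mul_le_mul_of_nonneg_left (Real.sqrt_le_sqrt e1) hL.le
      _ = _ := e2
      _ ≤ _ := mul_le_mul_of_nonneg_left (e3 G subset_rfl) (Real.sqrt_nonneg _)
  have hlog2 : Real.log 2 ≤ Real.log n := Real.log_le_log (by norm_num) hn2
  have hcard : (G.card : ℝ) ≤ Real.exp (3 * d * Real.log n) := by
    have h1 : G.card ≤ (n ^ 2 + 1) ^ d :=
      (Finset.card_filter_le _ _).trans (card_connectivityGrid_le K (n ^ 2))
    have h2 : n ^ 2 + 1 ≤ n ^ 3 := by
      nlinarith [Nat.pow_le_pow_left hn 2]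
    have h3 : (G.card : ℝ) ≤ ((n : ℝ) ^ 3) ^ d := by
      exact_mod_cast h1.trans (Nat.pow_le_pow_left h2 d)
    refine h3.trans (le_of_eq ?_)
    rw [← pow_mul, ← Real.exp_log (show (0 : ℝ) < (n : ℝ) ^ (3 * d) by positivity), Real.log_pow]
    push_cast
    ring_nf
  have hsqrt : √(2 * E) ≤ Real.exp ((1 + C / 2) * Real.log n) := by
    refine Real.sqrt_le_iff.2 ⟨(Real.exp_pos _).le, ?_⟩
    rw [← Real.exp_nat_mul, hE, ← Real.exp_log (show (0 : ℝ) < 2 by norm_num), ← Real.exp_add]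
    refine Real.exp_le_exp.2 ?_
    rw [Real.exp_log (by norm_num)]
    have := Real.log_nonneg (show (1 : ℝ) ≤ 2 by norm_num)
    push_cast
    nlinarith
  calc _ ≤ ∑ A : SimpleGraph (Fin n), √(2 * E) *
        ∑ B' ∈ G, √(likelihood A Z₀ B₀ * likelihood A Z B') :=
        Finset.sum_le_sum fun A _ => hterm A
    _ = √(2 * E) * ∑ B' ∈ G, ∑ A : SimpleGraph (Fin n),
        √(likelihood A Z₀ B₀ * likelihood A Z B') := by rw [← Finset.mul_sum, Finset.sum_comm]
    _ ≤ √(2 * E) * ∑ B' ∈ G, Real.exp (-D) := by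
        refine mul_le_mul_of_nonneg_left (Finset.sum_le_sum fun B' hB' => ?_) (Real.sqrt_nonneg _)
        exact (sum_sqrt_likelihood_le Z₀ Z hB₀' (hGconn B' hB')).trans
          (Real.exp_le_exp.2 (neg_le_neg (hGD B' hB')))
    _ = √(2 * E) * G.card * Real.exp (-D) := by rw [Finset.sum_const, nsmul_eq_mul]; ring
    _ ≤ Real.exp ((1 + C / 2) * Real.log n) * Real.exp (3 * d * Real.log n) *
        Real.exp (-D) := by gcongr
    _ = _ := by rw [← Real.exp_add, ← Real.exp_add]; ring_nf

/-! ### Counting pairs of nodes -/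

/-- The pairs of nodes with one end in `S` and the other end in `T`. -/
def pairsBetween {n : ℕ} (S T : Finset (Fin n)) : Finset (Fin n × Fin n) :=
  {e ∈ nodePairs n | e.1 ∈ S ∧ e.2 ∈ T ∨ e.1 ∈ T ∧ e.2 ∈ S}

/-- In S × T an unordered pair appears at most twice, and the diagonal accounts for at most n
elements. -/
theorem card_pairsBetween_ge {n : ℕ} (S T : Finset (Fin n)) :
    (S.card : ℝ) * T.card - n ≤ 2 * (pairsBetween S T).card := by
  have hsub : S ×ˢ T ⊆ (Finset.univ.image fun i : Fin n => (i, i)) ∪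
      (pairsBetween S T ∪ (pairsBetween S T).image Prod.swap) := by
    rintro ⟨i, j⟩ h
    rw [Finset.mem_product] at h
    rcases lt_trichotomy i j with hij | hij | hij
    · refine Finset.mem_union_right _ (Finset.mem_union_left _ ?_)
      simp only [pairsBetween, Finset.mem_filter, Finset.mem_univ, true_and]
      exact ⟨hij, Or.inl h⟩
    · subst hij
      exact Finset.mem_union_left _ (Finset.mem_image.2 ⟨i, Finset.mem_univ _, rfl⟩)
    · refine Finset.mem_union_right _ (Finset.mem_union_right _ ?_)
      refine Finset.mem_image.2 ⟨(j, i), ?_, rfl⟩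
      simp only [pairsBetween, Finset.mem_filter, Finset.mem_univ, true_and]
      exact ⟨hij, Or.inr ⟨h.2, h.1⟩⟩
  have h1 := Finset.card_le_card hsub
  have h2 : S.card * T.card ≤ n + ((pairsBetween S T).card + (pairsBetween S T).card) := by
    rw [← Finset.card_product]
    refine h1.trans ((Finset.card_union_le _ _).trans (add_le_add ?_
      ((Finset.card_union_le _ _).trans (add_le_add le_rfl Finset.card_image_le))))
    exact Finset.card_image_le.trans (by simp)
  have h3 : (S.card : ℝ) * T.card ≤ n + ((pairsBetween S T).card + (pairsBetween S T).card) := by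
    exact_mod_cast h2
  linarith

/-- The pairs of nodes whose co-membership differs between `Z₀` and `Z`. -/
def flippedPairs {n K : ℕ} (Z₀ Z : Fin n → Fin K) : Finset (Fin n × Fin n) :=
  {e ∈ nodePairs n | ¬(Z₀ e.1 = Z₀ e.2 ↔ Z e.1 = Z e.2)}

/-- The pairs of nodes at least one of which is mislabelled. -/
def touchedPairs {n K : ℕ} (Z₀ Z : Fin n → Fin K) : Finset (Fin n × Fin n) :=
  {e ∈ nodePairs n | Z e.1 ≠ Z₀ e.1 ∨ Z e.2 ≠ Z₀ e.2}

theorem flippedPairs_subset_touchedPairs {n K : ℕ} (Z₀ Z : Fin n → Fin K) :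
    flippedPairs Z₀ Z ⊆ touchedPairs Z₀ Z := by
  intro e he
  simp only [flippedPairs, touchedPairs, Finset.mem_filter] at he ⊢
  refine ⟨he.1, ?_⟩
  by_contra h
  push Not at h
  exact he.2 (by rw [h.1, h.2])

theorem card_touchedPairs_le {n K : ℕ} (Z₀ Z : Fin n → Fin K) :
    (touchedPairs Z₀ Z).card ≤ 2 * hammingDist Z Z₀ * n := by
  have hsub : touchedPairs Z₀ Z ⊆
      (({i | Z i ≠ Z₀ i} : Finset (Fin n)) ×ˢ Finset.univ) ∪
        (Finset.univ ×ˢ ({i | Z i ≠ Z₀ i} : Finset (Fin n))) := by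
    intro e he
    simp only [touchedPairs, Finset.mem_filter] at he
    simpa using he.2
  refine (Finset.card_le_card hsub).trans ((Finset.card_union_le _ _).trans (le_of_eq ?_))
  rw [Finset.card_product, Finset.card_product, Finset.card_univ, Fintype.card_fin, hammingDist]
  simp only [ne_eq]
  ring

/-- This is the origin of the case distinction in `effectiveSize`: two communities exhaust the nodes
when K = 2, and otherwise only the lower size bound n/(Kβ) is available for each. -/
theorem two_mul_effectiveSize_le {n K : ℕ} {β : ℝ} {Z₀ : Fin n → Fin K}
    (hZ₀ : Z₀ ∈ balanced n K β) {k l : Fin K} (hkl : k ≠ l) :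
    2 * effectiveSize K β n ≤ (communitySize Z₀ k : ℝ) + communitySize Z₀ l := by
  unfold effectiveSize
  split_ifs with h
  · subst h
    have hu : ({i | Z₀ i = k} : Finset (Fin n)) ∪ ({i | Z₀ i = l} : Finset (Fin n)) =
        Finset.univ := by
      ext i
      simp only [Finset.mem_union, Finset.mem_filter, Finset.mem_univ, true_and, iff_true]
      omega
    have h1 := Finset.card_union_le ({i | Z₀ i = k} : Finset (Fin n))
      ({i | Z₀ i = l} : Finset (Fin n))
    rw [hu, Finset.card_univ, Fintype.card_fin] at h1
    have h2 : (n : ℝ) ≤ (communitySize Z₀ k : ℝ) + communitySize Z₀ l := by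
      unfold communitySize; exact_mod_cast h1
    linarith
  · have hb := (Finset.mem_filter.1 hZ₀).2
    have h1 := (hb k).1
    have h2 := (hb l).1
    rw [mul_comm (K : ℝ)]
    linarith

/-- Each mislabelled node flips its pairs with the correctly labelled nodes of its old and its
new community. -/
theorem card_flippedPairs_ge {n K : ℕ} {β : ℝ} {Z₀ : Fin n → Fin K}
    (hZ₀ : Z₀ ∈ balanced n K β) (Z : Fin n → Fin K) :
    (hammingDist Z Z₀ : ℝ) * (2 * effectiveSize K β n - hammingDist Z Z₀) ≤
      (flippedPairs Z₀ Z).card := by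
  set W : Finset (Fin n) := {i | Z i ≠ Z₀ i} with hW
  have hd : hammingDist Z Z₀ = W.card := by
    rw [hammingDist, hW]
  set S : Fin n → Finset (Fin n) := fun i => {j | Z j = Z₀ j ∧ (Z₀ j = Z₀ i ∨ Z₀ j = Z i)} with hS
  have hScard : ∀ i ∈ W, 2 * effectiveSize K β n - W.card ≤ ((S i).card : ℝ) := by
    intro i hi
    have hne : Z i ≠ Z₀ i := by simpa [hW] using hi
    have h1 := two_mul_effectiveSize_le hZ₀ hne.symm
    have hsub : ({j | Z₀ j = Z₀ i} : Finset (Fin n)) ∪ ({j | Z₀ j = Z i} : Finset (Fin n)) ⊆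
        W ∪ S i := by
      intro j hj
      simp only [hW, hS, Finset.mem_union, Finset.mem_filter, Finset.mem_univ, true_and] at hj ⊢
      tauto
    have hdisj : Disjoint ({j | Z₀ j = Z₀ i} : Finset (Fin n))
        ({j | Z₀ j = Z i} : Finset (Fin n)) := by
      rw [Finset.disjoint_filter]
      intro j _ h h'
      exact hne (h'.symm.trans h)
    have h2 := (Finset.card_le_card hsub).trans (Finset.card_union_le _ _)
    rw [Finset.card_union_of_disjoint hdisj] at h2
    have h3 : (communitySize Z₀ (Z₀ i) : ℝ) + communitySize Z₀ (Z i) ≤ W.card + (S i).card := by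
      unfold communitySize; exact_mod_cast h2
    linarith
  -- Each pair combines one mislabelled and one correctly labelled node, so it cannot arise again
  -- with the roles exchanged.
  have hinj : (W.sigma S).card ≤ (flippedPairs Z₀ Z).card := by
    refine Finset.card_le_card_of_injOn
      (fun x => if x.1 < x.2 then (x.1, x.2) else (x.2, x.1)) ?_ ?_
    · rintro ⟨i, j⟩ hx
      have hx := Finset.mem_sigma.1 hx
      simp only [hW, hS, Finset.mem_filter, Finset.mem_univ, true_and] at hx
      obtain ⟨h1, h2, h3⟩ := hx
      have hij : i ≠ j := by rintro rfl; exact h1 h2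
      have hne : ¬(Z₀ i = Z₀ j ↔ Z i = Z j) := by
        rw [h2]
        rcases h3 with h3 | h3
        · rw [h3]; simpa using h1
        · rw [h3]
          simpa using fun h => h1 h.symm
      simp only [flippedPairs]
      by_cases hlt : i < j
      · simp [hlt, hne]
      · have hlt' : j < i := lt_of_le_of_ne (not_lt.1 hlt) hij.symm
        have hne' : ¬(Z₀ j = Z₀ i ↔ Z j = Z i) := by
          rwa [eq_comm, eq_comm (a := Z j)]
        simp [hlt, hlt', hne']
    · rintro ⟨i, j⟩ hx ⟨i', j'⟩ hx' h
      have hx := Finset.mem_sigma.1 hx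
      have hx' := Finset.mem_sigma.1 hx'
      simp only [hW, hS, Finset.mem_filter, Finset.mem_univ, true_and] at hx hx'
      simp only at h
      have key : (i = i' ∧ j = j') ∨ (i = j' ∧ j = i') := by
        split_ifs at h <;> simp only [Prod.mk.injEq] at h <;> tauto
      rcases key with ⟨rfl, rfl⟩ | ⟨rfl, rfl⟩
      · rfl
      · exact absurd hx'.2.1 hx.1
  rw [Finset.card_sigma] at hinj
  have h4 : ∑ i ∈ W, (2 * effectiveSize K β n - W.card) ≤ ∑ i ∈ W, ((S i).card : ℝ) :=
    Finset.sum_le_sum hScard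
  rw [Finset.sum_const, nsmul_eq_mul] at h4
  have h5 : ∑ i ∈ W, ((S i).card : ℝ) ≤ (flippedPairs Z₀ Z).card := by exact_mod_cast hinj
  rw [hd]
  linarith

/-- The pairs of nodes with labels `c`. -/
def blockPairs {n K : ℕ} (Z : Fin n → Fin K) (c : Sym2 (Fin K)) : Finset (Fin n × Fin n) :=
  {e ∈ nodePairs n | pairLabel Z e = c}

theorem card_blockPairs_ge {n K : ℕ} {α : ℝ} (hα : 0 < α) {Z : Fin n → Fin K}
    (hZ : Z ∈ balanced n K α) (c : Sym2 (Fin K)) :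
    ((n : ℝ) / (α * K)) ^ 2 - n ≤ 2 * (blockPairs Z c).card := by
  induction c using Sym2.ind with
  | _ a b =>
  have hb := (Finset.mem_filter.1 hZ).2
  have h := card_pairsBetween_ge ({i | Z i = a} : Finset (Fin n)) ({i | Z i = b} : Finset (Fin n))
  have heq : pairsBetween ({i | Z i = a} : Finset (Fin n)) ({i | Z i = b} : Finset (Fin n)) =
      blockPairs Z s(a, b) := by
    ext e
    simp [pairsBetween, blockPairs]
  rw [heq] at h
  have h1 : (n : ℝ) / (α * K) * (n / (α * K)) ≤ (communitySize Z a : ℝ) * communitySize Z b :=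
    mul_le_mul (hb a).1 (hb b).1 (by positivity) (by positivity)
  unfold communitySize at h1
  nlinarith

/-! ### Lower bounds for the Hellinger distance -/

theorem homogeneousB_pairLabel {n K : ℕ} (Z : Fin n → Fin K) (p q : ℝ) (e : Fin n × Fin n) :
    homogeneousB K p q (pairLabel Z e) = if Z e.1 = Z e.2 then p else q := by
  simp [homogeneousB]

theorem isConnectivity_homogeneousB {K : ℕ} {p q : ℝ} (hq : 0 ≤ q) (hqp : q ≤ p) (hp : p ≤ 1) :
    IsConnectivity (homogeneousB K p q) := by
  intro c
  unfold homogeneousB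
  split_ifs <;> constructor <;> linarith

theorem hellinger_summand_nonneg {n K : ℕ} (Z₀ Z : Fin n → Fin K) {B₀ B : Sym2 (Fin K) → ℝ}
    (h₀ : IsConnectivity B₀) (hB : IsConnectivity B) (e : Fin n × Fin n) :
    0 ≤ 1 - affinity (B₀ (pairLabel Z₀ e)) (B (pairLabel Z e)) :=
  sub_nonneg.2 (affinity_le_one (h₀ _).1 (h₀ _).2 (hB _).1 (hB _).2)

theorem sum_le_hellinger {n K : ℕ} (Z₀ Z : Fin n → Fin K) {B₀ B : Sym2 (Fin K) → ℝ}
    (h₀ : IsConnectivity B₀) (hB : IsConnectivity B) {s : Finset (Fin n × Fin n)}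
    (hs : s ⊆ nodePairs n) :
    ∑ e ∈ s, (1 - affinity (B₀ (pairLabel Z₀ e)) (B (pairLabel Z e))) ≤ hellinger Z₀ Z B₀ B :=
  Finset.sum_le_sum_of_subset_of_nonneg hs fun e _ _ => hellinger_summand_nonneg Z₀ Z h₀ hB e

theorem affinity_homogeneousB_of_flipped {n K : ℕ} {Z₀ Z : Fin n → Fin K} {p q : ℝ}
    {e : Fin n × Fin n} (he : ¬(Z₀ e.1 = Z₀ e.2 ↔ Z e.1 = Z e.2)) :
    affinity (homogeneousB K p q (pairLabel Z e)) (homogeneousB K p q (pairLabel Z₀ e)) =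
      affinity p q := by
  rw [homogeneousB_pairLabel, homogeneousB_pairLabel]
  by_cases h : Z₀ e.1 = Z₀ e.2
  · have h' : Z e.1 ≠ Z e.2 := fun h' => he ⟨fun _ => h', fun _ => h⟩
    rw [if_pos h, if_neg h', affinity_comm]
  · have h' : Z e.1 = Z e.2 := by tauto
    rw [if_neg h, if_pos h']

theorem homogeneousB_of_not_flipped {n K : ℕ} {Z₀ Z : Fin n → Fin K} {p q : ℝ}
    {e : Fin n × Fin n} (he : Z₀ e.1 = Z₀ e.2 ↔ Z e.1 = Z e.2) :
    homogeneousB K p q (pairLabel Z₀ e) = homogeneousB K p q (pairLabel Z e) := by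
  rw [homogeneousB_pairLabel, homogeneousB_pairLabel]
  simp only [he]

/-- If in each block the flipped pairs are a small minority, then no connectivity matrix fits the
flipped pairs much better than the true one. -/
theorem card_flippedPairs_mul_le_hellinger {n K : ℕ} (Z₀ Z : Fin n → Fin K) {p q : ℝ}
    (hq : 0 ≤ q) (hqp : q ≤ p) (hp : p ≤ 1) {B : Sym2 (Fin K) → ℝ} (hB : IsConnectivity B)
    {t : ℝ} (ht : 0 < t)
    (hmin : ∀ c, ((blockPairs Z c ∩ flippedPairs Z₀ Z).card : ℝ) ≤
      t * (blockPairs Z c \ flippedPairs Z₀ Z).card) :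
    (flippedPairs Z₀ Z).card * (1 - affinity p q) ≤
      (1 + t) * hellinger Z₀ Z (homogeneousB K p q) B := by
  have h₀ := isConnectivity_homogeneousB (K := K) hq hqp hp
  set B₀ := homogeneousB K p q with hB₀
  have hh : 0 ≤ 1 - affinity p q :=
    sub_nonneg.2 (affinity_le_one (by linarith) hp hq (by linarith))
  have hblock : ∀ c, ((blockPairs Z c ∩ flippedPairs Z₀ Z).card : ℝ) * (1 - affinity p q) ≤
      (1 + t) * ∑ e ∈ blockPairs Z c,
        (1 - affinity (B₀ (pairLabel Z₀ e)) (B (pairLabel Z e))) := by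
    intro c
    set F := blockPairs Z c ∩ flippedPairs Z₀ Z with hF
    set U := blockPairs Z c \ flippedPairs Z₀ Z with hU
    rcases F.eq_empty_or_nonempty with hFe | ⟨e₀, he₀⟩
    · rw [hFe]
      simp only [Finset.card_empty, Nat.cast_zero, zero_mul]
      exact mul_nonneg (by linarith)
        (Finset.sum_nonneg fun e _ => hellinger_summand_nonneg Z₀ Z h₀ hB e)
    have hlabel : ∀ e ∈ blockPairs Z c, pairLabel Z e = c := fun e he =>
      (Finset.mem_filter.1 he).2
    set z := B₀ (pairLabel Z₀ e₀) with hz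
    have haff : affinity (B₀ c) z = affinity p q := by
      have he := Finset.mem_inter.1 he₀
      rw [← hlabel e₀ he.1, hz, hB₀]
      exact affinity_homogeneousB_of_flipped (Finset.mem_filter.1 he.2).2
    -- all flipped pairs of the block have the same true edge probability
    have hsame : ∀ e ∈ F, B₀ (pairLabel Z₀ e) = z := by
      intro e he
      have he := Finset.mem_inter.1 he
      have he₀ := Finset.mem_inter.1 he₀
      have h1 := (Finset.mem_filter.1 he.2).2
      have h2 := (Finset.mem_filter.1 he₀.2).2
      have h3 : (Z e.1 = Z e.2) ↔ (Z e₀.1 = Z e₀.2) := by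
        have := (hlabel e he.1).trans (hlabel e₀ he₀.1).symm
        have h4 : (pairLabel Z e).IsDiag ↔ (pairLabel Z e₀).IsDiag := by rw [this]
        simpa using h4
      rw [hz, hB₀, homogeneousB_pairLabel, homogeneousB_pairLabel]
      have h5 : (Z₀ e.1 = Z₀ e.2) ↔ (Z₀ e₀.1 = Z₀ e₀.2) := by tauto
      simp only [h5]
    have hsplit : ∑ e ∈ blockPairs Z c,
        (1 - affinity (B₀ (pairLabel Z₀ e)) (B (pairLabel Z e))) =
        F.card * (1 - affinity z (B c)) + U.card * (1 - affinity (B₀ c) (B c)) := by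
      rw [← Finset.sum_inter_add_sum_sdiff (blockPairs Z c) (flippedPairs Z₀ Z)]
      congr 1
      · rw [← nsmul_eq_mul, ← Finset.sum_const]
        refine Finset.sum_congr rfl fun e he => ?_
        rw [hsame e he, hlabel e (Finset.mem_inter.1 he).1]
      · rw [← nsmul_eq_mul, ← Finset.sum_const]
        refine Finset.sum_congr rfl fun e he => ?_
        have he := Finset.mem_sdiff.1 he
        have h1 : Z₀ e.1 = Z₀ e.2 ↔ Z e.1 = Z e.2 := by
          by_contra hcon
          exact he.2 (Finset.mem_filter.2 ⟨(Finset.mem_filter.1 he.1).1, hcon⟩)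
        rw [hB₀, homogeneousB_of_not_flipped h1, hlabel e he.1]
    rw [hsplit]
    -- The single value `B c` has to fit both the unflipped majority, with probability `B₀ c`, and
    -- the flipped pairs, with probability z. Moving it towards z is charged to the majority through
    -- `hmin`.
    have htri := hellinger_triangle (t := t) (h₀ c).1 (h₀ c).2 (h₀ (pairLabel Z₀ e₀)).1
      (h₀ (pairLabel Z₀ e₀)).2 (hB c).1 (hB c).2
    rw [← hz, haff] at htri
    have hnn : 0 ≤ 1 - affinity (B₀ c) (B c) :=
      sub_nonneg.2 (affinity_le_one (h₀ c).1 (h₀ c).2 (hB c).1 (hB c).2)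
    have h6 := mul_le_mul_of_nonneg_right (hmin c) hnn
    have h7 := mul_le_mul_of_nonneg_left htri (Nat.cast_nonneg (α := ℝ) F.card)
    have h8 : t * (F.card * (1 - affinity p q)) ≤ t * ((1 + t) *
        (F.card * (1 - affinity z (B c)) + U.card * (1 - affinity (B₀ c) (B c)))) := by
      nlinarith
    exact le_of_mul_le_mul_left h8 ht
  have hsum1 : ((flippedPairs Z₀ Z).card : ℝ) =
      ∑ c : Sym2 (Fin K), ((blockPairs Z c ∩ flippedPairs Z₀ Z).card : ℝ) := by
    rw [Finset.card_eq_sum_card_fiberwise (f := pairLabel Z) (t := Finset.univ) (by simp)]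
    push_cast
    refine Finset.sum_congr rfl fun c _ => ?_
    congr 2
    ext e
    simp only [blockPairs, flippedPairs, Finset.mem_filter, Finset.mem_inter]
    tauto
  have hsum2 : hellinger Z₀ Z B₀ B = ∑ c : Sym2 (Fin K), ∑ e ∈ blockPairs Z c,
      (1 - affinity (B₀ (pairLabel Z₀ e)) (B (pairLabel Z e))) :=
    (Finset.sum_fiberwise _ _ _).symm
  rw [hsum1, hsum2, Finset.sum_mul, Finset.mul_sum]
  exact Finset.sum_le_sum fun c _ => hblock c

/-- A connectivity matrix with a misfitting entry is far from the truth. -/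
theorem card_mul_le_hellinger {n K : ℕ} (Z₀ Z : Fin n → Fin K) {p q : ℝ}
    (hq : 0 < q) (hqp : q ≤ p) (hp : p ≤ 1) {B : Sym2 (Fin K) → ℝ} (hB : IsConnectivity B)
    {δ : ℝ} (hδ0 : 0 ≤ δ) (hδ1 : δ ≤ 1) {c : Sym2 (Fin K)}
    (hc : δ * homogeneousB K p q c ≤ |B c - homogeneousB K p q c|) :
    ((blockPairs Z c \ flippedPairs Z₀ Z).card : ℝ) * (δ ^ 2 * q / 18) ≤
      hellinger Z₀ Z (homogeneousB K p q) B := by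
  have h₀ := isConnectivity_homogeneousB (K := K) hq.le hqp hp
  refine le_trans ?_ (sum_le_hellinger Z₀ Z h₀ hB (s := blockPairs Z c \ flippedPairs Z₀ Z)
    (Finset.sdiff_subset.trans (Finset.filter_subset _ _)))
  rw [← nsmul_eq_mul, ← Finset.sum_const]
  refine Finset.sum_le_sum fun e he => ?_
  have he := Finset.mem_sdiff.1 he
  have h1 : Z₀ e.1 = Z₀ e.2 ↔ Z e.1 = Z e.2 := by
    by_contra hcon
    exact he.2 (Finset.mem_filter.2 ⟨(Finset.mem_filter.1 he.1).1, hcon⟩)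
  rw [homogeneousB_of_not_flipped h1, (Finset.mem_filter.1 he.1).2]
  have hge : q ≤ homogeneousB K p q c := by unfold homogeneousB; split_ifs <;> linarith
  refine le_trans ?_ (one_sub_affinity_ge (hB c).1 (hB c).2 (by linarith) (h₀ c).2 hδ0 hδ1 hc)
  gcongr

/-- Labels that are far from all relabellings of the true ones are far in Hellinger distance, for
every connectivity matrix. -/
theorem exists_mul_sq_le_hellinger (K : ℕ) (hK : 1 ≤ K) {α β ε : ℝ} (hα : 0 < α) (hβ : 0 < β)
    (hε : 0 < ε) : ∃ c : ℝ, 0 < c ∧ ∃ n₀ : ℕ, ∀ n ≥ n₀, ∀ Z₀ ∈ balanced n K β,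
      ∀ Z ∈ balanced n K α, (∀ σ : Equiv.Perm (Fin K), ε * n < hammingDist (σ ∘ Z) Z₀) →
      ∀ p q : ℝ, 0 ≤ q → q ≤ p → p ≤ 1 → ∀ B, IsConnectivity B →
        c * (n : ℝ) ^ 2 * (1 - affinity p q) ≤ hellinger Z₀ Z (homogeneousB K p q) B := by
  have hK0 : (0 : ℝ) < K := by exact_mod_cast hK
  -- An intersection of a community of Z with a true one counts as large from s n nodes on. K small
  -- intersections cannot fill a community of either labelling, and K² of them hold at most εn
  -- nodes.
  obtain ⟨s, hs0, hsα, hsβ, hsε⟩ : ∃ s : ℝ, 0 < s ∧ K * s < 1 / (α * K) ∧ K * s < 1 / (β * K) ∧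
      K * (K * s) ≤ ε := by
    refine ⟨min (min (1 / (2 * α * K * K)) (1 / (2 * β * K * K))) (ε / (K * K)),
      by positivity, ?_, ?_, ?_⟩
    · have h : min (min (1 / (2 * α * K * K)) (1 / (2 * β * K * K))) (ε / (K * K)) ≤
        1 / (2 * α * K * K) := (min_le_left _ _).trans (min_le_left _ _)
      refine (mul_le_mul_of_nonneg_left h hK0.le).trans_lt ?_
      have : (K : ℝ) * (1 / (2 * α * K * K)) = 1 / (α * K) / 2 := by field_simp
      rw [this]; exact half_lt_self (by positivity)
    · have h : min (min (1 / (2 * α * K * K)) (1 / (2 * β * K * K))) (ε / (K * K)) ≤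
        1 / (2 * β * K * K) := (min_le_left _ _).trans (min_le_right _ _)
      refine (mul_le_mul_of_nonneg_left h hK0.le).trans_lt ?_
      have : (K : ℝ) * (1 / (2 * β * K * K)) = 1 / (β * K) / 2 := by field_simp
      rw [this]; exact half_lt_self (by positivity)
    · have h : min (min (1 / (2 * α * K * K)) (1 / (2 * β * K * K))) (ε / (K * K)) ≤
        ε / (K * K) := min_le_right _ _
      have h2 : (K : ℝ) * (K * (ε / (K * K))) = ε := by field_simp
      exact (mul_le_mul_of_nonneg_left (mul_le_mul_of_nonneg_left h hK0.le) hK0.le).trans h2.le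
  -- Two large intersections provide s²n²/4 pairs of each kind once s²n ≥ 2, and the triangle
  -- inequality with t = 1 loses a factor 2.
  refine ⟨s ^ 2 / 8, by positivity, max 1 ⌈2 / s ^ 2⌉₊, ?_⟩
  intro n hn Z₀ hZ₀ Z hZ hfar p q hq hqp hp B hB
  have hn1 : 1 ≤ n := (le_max_left _ _).trans hn
  have hn0 : (0 : ℝ) < n := by exact_mod_cast hn1
  have hns : 2 ≤ s ^ 2 * n := by
    have h1 : 2 / s ^ 2 ≤ n :=
      (Nat.le_ceil _).trans (by exact_mod_cast (le_max_right _ _).trans hn)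
    rw [div_le_iff₀ (by positivity)] at h1
    linarith
  have h₀ := isConnectivity_homogeneousB (K := K) hq hqp hp
  set S : Fin K → Fin K → Finset (Fin n) := fun a k => {i | Z i = a ∧ Z₀ i = k} with hS
  -- If a community of Z has two large intersections, its diagonal block contains many pairs with
  -- probability p and many with q, and no single value fits both. If none has two, the large
  -- intersections define a permutation that leaves at most εn errors, contrary to `hfar`.
  by_cases hcase : ∃ a k l, k ≠ l ∧ s * n ≤ (S a k).card ∧ s * n ≤ (S a l).card
  · obtain ⟨a, k, l, hkl, hk, hl⟩ := hcase
    set b := B s(a, a) with hb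
    set N : ℝ := s ^ 2 * (n : ℝ) ^ 2 / 4 with hN
    have hcount : ∀ m, s * n ≤ (S a m).card → N ≤ (pairsBetween (S a k) (S a m)).card := by
      intro m hm
      have h1 := card_pairsBetween_ge (S a k) (S a m)
      have h2 : s * n * (s * n) ≤ ((S a k).card : ℝ) * (S a m).card :=
        mul_le_mul hk hm (by positivity) (by positivity)
      rw [hN]
      nlinarith
    have hdisj : Disjoint (pairsBetween (S a k) (S a k)) (pairsBetween (S a k) (S a l)) := by
      rw [Finset.disjoint_left]
      intro e he he'
      simp only [pairsBetween, hS, Finset.mem_filter, Finset.mem_univ, true_and] at he he'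
      rcases he.2 with h | h <;> rcases he'.2 with h' | h' <;>
        first
          | exact hkl (h.2.2.symm.trans h'.2.2)
          | exact hkl (h.1.2.symm.trans h'.1.2)
    have hsum := sum_le_hellinger Z₀ Z h₀ hB
      (s := pairsBetween (S a k) (S a k) ∪ pairsBetween (S a k) (S a l))
      (Finset.union_subset (Finset.filter_subset _ _) (Finset.filter_subset _ _))
    rw [Finset.sum_union hdisj] at hsum
    have e1 : ∑ e ∈ pairsBetween (S a k) (S a k),
        (1 - affinity (homogeneousB K p q (pairLabel Z₀ e)) (B (pairLabel Z e))) =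
        (pairsBetween (S a k) (S a k)).card * (1 - affinity p b) := by
      rw [← nsmul_eq_mul, ← Finset.sum_const]
      refine Finset.sum_congr rfl fun e he => ?_
      simp only [pairsBetween, hS, Finset.mem_filter, Finset.mem_univ, true_and] at he
      have h : (Z e.1 = a ∧ Z₀ e.1 = k) ∧ Z e.2 = a ∧ Z₀ e.2 = k := by tauto
      rw [homogeneousB_pairLabel, if_pos (by rw [h.1.2, h.2.2]), pairLabel, h.1.1, h.2.1]
    have e2 : ∑ e ∈ pairsBetween (S a k) (S a l),
        (1 - affinity (homogeneousB K p q (pairLabel Z₀ e)) (B (pairLabel Z e))) =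
        (pairsBetween (S a k) (S a l)).card * (1 - affinity q b) := by
      rw [← nsmul_eq_mul, ← Finset.sum_const]
      refine Finset.sum_congr rfl fun e he => ?_
      simp only [pairsBetween, hS, Finset.mem_filter, Finset.mem_univ, true_and] at he
      rcases he.2 with h | h
      · rw [homogeneousB_pairLabel, if_neg (by rw [h.1.2, h.2.2]; exact hkl), pairLabel,
          h.1.1, h.2.1]
      · rw [homogeneousB_pairLabel, if_neg (by rw [h.1.2, h.2.2]; exact hkl.symm), pairLabel,
          h.1.1, h.2.1]
    rw [e1, e2] at hsum
    have hbb := hB s(a, a)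
    have hnp : 0 ≤ 1 - affinity p b :=
      sub_nonneg.2 (affinity_le_one (by linarith) hp hbb.1 hbb.2)
    have hnq : 0 ≤ 1 - affinity q b :=
      sub_nonneg.2 (affinity_le_one hq (by linarith) hbb.1 hbb.2)
    have htri := hellinger_triangle (t := 1) (by linarith : (0 : ℝ) ≤ p) hp hq
      (by linarith : q ≤ 1) hbb.1 hbb.2
    rw [← hb] at htri
    have f1 := mul_le_mul_of_nonneg_right (hcount k hk) hnp
    have f2 := mul_le_mul_of_nonneg_right (hcount l hl) hnq
    have f3 : 0 ≤ N := by positivity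
    have f4 := mul_le_mul_of_nonneg_left htri f3
    rw [hN] at f1 f2 f4
    nlinarith
  · exfalso
    push Not at hcase
    have hrow : ∀ a, ∃ k, s * n ≤ (S a k).card := by
      intro a
      by_contra hcon
      push Not at hcon
      have h1 : (communitySize Z a : ℝ) = ∑ k, ((S a k).card : ℝ) := by
        unfold communitySize
        rw [Finset.card_eq_sum_card_fiberwise (f := Z₀) (t := Finset.univ) (by simp)]
        push_cast
        refine Finset.sum_congr rfl fun k _ => ?_
        rw [hS, Finset.filter_filter]
      have h2 : ∑ k, ((S a k).card : ℝ) ≤ ∑ _k : Fin K, s * n :=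
        Finset.sum_le_sum fun k _ => (hcon k).le
      rw [Finset.sum_const, Finset.card_univ, Fintype.card_fin, nsmul_eq_mul, ← h1] at h2
      have h3 := ((Finset.mem_filter.1 hZ).2 a).1
      have h4 := mul_lt_mul_of_pos_right hsα hn0
      rw [div_mul_eq_mul_div, one_mul] at h4
      linarith
    choose τ hτ using hrow
    have hsmall : ∀ a k, k ≠ τ a → ((S a k).card : ℝ) < s * n := fun a k hk =>
      hcase a (τ a) k hk.symm (hτ a)
    have hsurj : Function.Surjective τ := by
      intro l
      by_contra hcon
      push Not at hcon
      have h1 : (communitySize Z₀ l : ℝ) = ∑ a, ((S a l).card : ℝ) := by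
        unfold communitySize
        rw [Finset.card_eq_sum_card_fiberwise (f := Z) (t := Finset.univ) (by simp)]
        push_cast
        refine Finset.sum_congr rfl fun k _ => ?_
        rw [hS, Finset.filter_filter]
        congr 2
        ext i
        simp only [Finset.mem_filter, Finset.mem_univ, true_and]
        tauto
      have h2 : ∑ a, ((S a l).card : ℝ) ≤ ∑ _a : Fin K, s * n :=
        Finset.sum_le_sum fun a _ => (hsmall a l (hcon a).symm).le
      rw [Finset.sum_const, Finset.card_univ, Fintype.card_fin, nsmul_eq_mul, ← h1] at h2
      have h3 := ((Finset.mem_filter.1 hZ₀).2 l).1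
      have h4 := mul_lt_mul_of_pos_right hsβ hn0
      rw [div_mul_eq_mul_div, one_mul] at h4
      linarith
    have hfarτ := hfar (Equiv.ofBijective τ (Finite.surjective_iff_bijective.1 hsurj))
    have hcover : ({i | τ (Z i) ≠ Z₀ i} : Finset (Fin n)) ⊆
        ({x : Fin K × Fin K | x.2 ≠ τ x.1} : Finset (Fin K × Fin K)).biUnion
          fun x => S x.1 x.2 := by
      intro i hi
      simp only [Finset.mem_filter, Finset.mem_univ, true_and] at hi
      simp only [hS, Finset.mem_biUnion, Finset.mem_filter, Finset.mem_univ, true_and]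
      exact ⟨(Z i, Z₀ i), hi.symm, rfl, rfl⟩
    have hcard := (Finset.card_le_card hcover).trans Finset.card_biUnion_le
    have h5 : (hammingDist (τ ∘ Z) Z₀ : ℝ) ≤
        ∑ x : Fin K × Fin K with x.2 ≠ τ x.1, ((S x.1 x.2).card : ℝ) := by
      unfold hammingDist
      simp only [Function.comp]
      exact_mod_cast hcard
    have h6 : ∑ x : Fin K × Fin K with x.2 ≠ τ x.1, ((S x.1 x.2).card : ℝ) ≤
        ∑ x : Fin K × Fin K with x.2 ≠ τ x.1, s * n :=
      Finset.sum_le_sum fun x hx => (hsmall x.1 x.2 (Finset.mem_filter.1 hx).2).le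
    have h7 : ∑ x : Fin K × Fin K with x.2 ≠ τ x.1, s * n ≤ ∑ _x : Fin K × Fin K, s * (n : ℝ) :=
      Finset.sum_le_sum_of_subset_of_nonneg (Finset.filter_subset _ _) fun _ _ _ => by positivity
    have hall : ∑ _x : Fin K × Fin K, s * (n : ℝ) = K * K * (s * n) := by simp
    rw [hall] at h7
    have h8 : (K : ℝ) * K * (s * n) ≤ ε * n := by
      have := mul_le_mul_of_nonneg_right hsε hn0.le
      linarith
    have h9 : ε * n < (hammingDist (τ ∘ Z) Z₀ : ℝ) := hfarτ
    linarith

/-! ### Connectivity matrices near the truth -/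

/-- The connectivity matrices whose entries have relative error at most `δ`. -/
def connectivityNhd {K : ℕ} (B₀ : Sym2 (Fin K) → ℝ) (δ : ℝ) : Set (Sym2 (Fin K) → ℝ) :=
  {B | ∀ c, |B c - B₀ c| ≤ δ * B₀ c}

theorem measurableSet_connectivityNhd {K : ℕ} (B₀ : Sym2 (Fin K) → ℝ) (δ : ℝ) :
    MeasurableSet (connectivityNhd B₀ δ) := by
  unfold connectivityNhd
  rw [Set.ofPred_forall]
  refine MeasurableSet.iInter fun c => measurableSet_le ?_ measurable_const
  fun_prop

/-- Bounds (1 + u)/(1 - u) by a square, so that the root of the likelihood ratio near the truth is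
explicit. -/
theorem one_add_le_sq_mul {u : ℝ} (h0 : 0 ≤ u) (h1 : u ≤ 1 / 2) :
    1 + u ≤ (1 + 2 * u) ^ 2 * (1 - u) := by
  nlinarith [mul_nonneg h0 h0, mul_nonneg h0 (mul_nonneg h0 (sub_nonneg.2 h1))]

theorem le_affinity_of_le {p q : ℝ} (hqp : q ≤ p) (hp : p ≤ 1) :
    1 - p ≤ affinity p q := by
  unfold affinity
  have h : 1 - p ≤ √((1 - p) * (1 - q)) := by
    refine Real.le_sqrt_of_sq_le ?_
    nlinarith
  linarith [Real.sqrt_nonneg (p * q)]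

theorem exp_neg_half_renyi {p q : ℝ} (h : 0 < affinity p q) :
    Real.exp (-(renyi p q / 2)) = affinity p q := by
  rw [renyi_eq, show -(-2 * Real.log (affinity p q) / 2) = Real.log (affinity p q) by ring,
    Real.exp_log h]

/-- The contribution of connectivity matrices near the truth to the expected root of the posterior
odds. -/
theorem sum_sqrt_setIntegral_nhd_le {n K : ℕ} {κ₁ κ₂ : ℝ} (h₁ : 0 < κ₁) (h₂ : 0 < κ₂)
    (hn : 2 ≤ n) (Z₀ Z : Fin n → Fin K) {p q δ : ℝ} (hq : 0 < q) (hqp : q ≤ p) (hp : p ≤ 1 / 2)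
    (hδ0 : 0 ≤ δ) (hδ1 : δ ≤ 1 / 2) :
    ∑ A : SimpleGraph (Fin n), likelihood A Z₀ (homogeneousB K p q) *
      √((∫ B in connectivityNhd (homogeneousB K p q) δ, likelihood A Z B
          ∂connectivityPrior K κ₁ κ₂) / marginalLikelihood κ₁ κ₂ A Z₀) ≤
      Real.exp (12 * δ * p * (touchedPairs Z₀ Z).card -
        renyi p q / 2 * (flippedPairs Z₀ Z).card) := by
  set B₀ := homogeneousB K p q with hB₀
  have hBb : ∀ c, q ≤ B₀ c ∧ B₀ c ≤ p := by
    intro c; rw [hB₀]; unfold homogeneousB; split_ifs <;> constructor <;> linarith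
  set P : Fin n × Fin n → ℝ := fun e => B₀ (pairLabel Z₀ e) with hP
  set Q : Fin n × Fin n → ℝ := fun e => B₀ (pairLabel Z e) with hQ
  have hPb : ∀ e, q ≤ P e ∧ P e ≤ p := fun e => hBb _
  have hQb : ∀ e, q ≤ Q e ∧ Q e ≤ p := fun e => hBb _
  set tch : Fin n × Fin n → Prop := fun e => Z e.1 ≠ Z₀ e.1 ∨ Z e.2 ≠ Z₀ e.2 with htch
  -- The squares of ξ and υ bound the factors of the likelihood ratio of Z to Z₀ at edges and
  -- non-edges, uniformly over the neighbourhood. A relative error δ in `B₀ c` ≤ p ≤ 1/2 is one of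
  -- at most 2δp in 1 - `B₀ c`. An untouched pair has the same label under both, so its factor is
  -- exactly 1.
  set ξ : Fin n × Fin n → ℝ := fun e =>
    if tch e then √(Q e) / √(P e) * (1 + 2 * δ) else 1 with hξ
  set υ : Fin n × Fin n → ℝ := fun e =>
    if tch e then √(1 - Q e) / √(1 - P e) * (1 + 4 * δ * p) else 1 with hυ
  have hp0 : 0 < p := by linarith
  have hξ0 : ∀ e, 0 ≤ ξ e := by intro e; simp only [hξ]; split_ifs <;> positivity
  have hυ0 : ∀ e, 0 ≤ υ e := by intro e; simp only [hυ]; split_ifs <;> positivity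
  set g : SimpleGraph (Fin n) → ℝ := fun A =>
    ∏ e ∈ nodePairs n, if A.Adj e.1 e.2 then ξ e else υ e with hg
  have hg0 : ∀ A, 0 ≤ g A := fun A => Finset.prod_nonneg fun e _ => by
    split_ifs
    · exact hξ0 e
    · exact hυ0 e
  have hu : 2 * δ * p ≤ 1 / 2 := by nlinarith
  have hu0 : 0 ≤ 2 * δ * p := by positivity
  have hlik : ∀ A, ∀ B ∈ connectivityNhd B₀ δ,
      likelihood A Z B ≤ g A ^ 2 * likelihood A Z₀ B := by
    intro A B hB
    have hbd : ∀ c, (1 - δ) * B₀ c ≤ B c ∧ B c ≤ (1 + δ) * B₀ c ∧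
        (1 - 2 * δ * p) * (1 - B₀ c) ≤ 1 - B c ∧ 1 - B c ≤ (1 + 2 * δ * p) * (1 - B₀ c) := by
      intro c
      have h := abs_le.1 (hB c)
      have hc := hBb c
      have h3 : δ * B₀ c ≤ 2 * δ * p * (1 - B₀ c) := by
        have : B₀ c ≤ 2 * p * (1 - B₀ c) := by nlinarith
        nlinarith
      refine ⟨by linarith, by linarith, by linarith, by linarith⟩
    rw [hg, ← Finset.prod_pow, likelihood_eq, likelihood_eq, ← Finset.prod_mul_distrib]
    refine Finset.prod_le_prod (fun e _ => ?_) fun e _ => ?_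
    · have h := hbd (pairLabel Z e)
      have hc := hBb (pairLabel Z e)
      split_ifs
      · exact le_trans (mul_nonneg (by linarith) (by linarith)) h.1
      · exact le_trans (mul_nonneg (by linarith) (by linarith)) h.2.2.1
    · by_cases ht : tch e
      · have hPe := hPb e
        have hQe := hQb e
        split_ifs
        · have e1 := (hbd (pairLabel Z e)).2.1
          have e2 := (hbd (pairLabel Z₀ e)).1
          have e3 : ξ e ^ 2 = Q e / P e * (1 + 2 * δ) ^ 2 := by
            simp only [hξ, if_pos ht]
            rw [mul_pow, div_pow, Real.sq_sqrt (by linarith), Real.sq_sqrt (by linarith)]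
          rw [e3]
          have hPpos : 0 < P e := by linarith
          have e4 : (1 + δ) * Q e ≤ Q e / P e * (1 + 2 * δ) ^ 2 * ((1 - δ) * P e) := by
            have : Q e / P e * (1 + 2 * δ) ^ 2 * ((1 - δ) * P e) =
                Q e * ((1 + 2 * δ) ^ 2 * (1 - δ)) := by field_simp
            rw [this, mul_comm]
            exact mul_le_mul_of_nonneg_left (one_add_le_sq_mul hδ0 hδ1) (by linarith)
          refine e1.trans (e4.trans (mul_le_mul_of_nonneg_left e2 ?_))
          have : 0 ≤ Q e := by linarith
          positivity
        · have e1 := (hbd (pairLabel Z e)).2.2.2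
          have e2 := (hbd (pairLabel Z₀ e)).2.2.1
          have e3 : υ e ^ 2 = (1 - Q e) / (1 - P e) * (1 + 2 * (2 * δ * p)) ^ 2 := by
            simp only [hυ, if_pos ht]
            rw [mul_pow, div_pow, Real.sq_sqrt (by linarith), Real.sq_sqrt (by linarith)]
            ring
          rw [e3]
          have hPpos : 0 < 1 - P e := by linarith
          have hQpos : 0 ≤ 1 - Q e := by linarith
          have e4 : (1 + 2 * δ * p) * (1 - Q e) ≤ (1 - Q e) / (1 - P e) *
              (1 + 2 * (2 * δ * p)) ^ 2 * ((1 - 2 * δ * p) * (1 - P e)) := by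
            have : (1 - Q e) / (1 - P e) * (1 + 2 * (2 * δ * p)) ^ 2 *
                ((1 - 2 * δ * p) * (1 - P e)) =
                (1 - Q e) * ((1 + 2 * (2 * δ * p)) ^ 2 * (1 - 2 * δ * p)) := by field_simp
            rw [this, mul_comm]
            exact mul_le_mul_of_nonneg_left (one_add_le_sq_mul hu0 hu) hQpos
          exact e1.trans (e4.trans (mul_le_mul_of_nonneg_left e2 (by positivity)))
      · have hlab : pairLabel Z e = pairLabel Z₀ e := by
          simp only [htch, not_or, not_not] at ht
          rw [pairLabel, ht.1, ht.2]
        have e1 : ξ e = 1 := by simp only [hξ, if_neg ht]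
        have e2 : υ e = 1 := by simp only [hυ, if_neg ht]
        rw [hlab, e1, e2]
        split_ifs <;> simp
  -- Since g does not depend on B, it leaves the integral, and the rest is at most the marginal
  -- likelihood of Z₀.
  have hterm : ∀ A, √((∫ B in connectivityNhd B₀ δ, likelihood A Z B
      ∂connectivityPrior K κ₁ κ₂) / marginalLikelihood κ₁ κ₂ A Z₀) ≤ g A := by
    intro A
    refine Real.sqrt_le_iff.2 ⟨hg0 A, ?_⟩
    rw [div_le_iff₀ (marginalLikelihood_pos h₁ h₂ hn A Z₀)]
    have hi := integrable_likelihood h₁ h₂ A Z₀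
    calc _ ≤ ∫ B in connectivityNhd B₀ δ, g A ^ 2 * likelihood A Z₀ B
          ∂connectivityPrior K κ₁ κ₂ :=
          setIntegral_mono_on (integrable_likelihood h₁ h₂ A Z).integrableOn
            (hi.const_mul _).integrableOn (measurableSet_connectivityNhd B₀ δ) (hlik A)
      _ = g A ^ 2 * ∫ B in connectivityNhd B₀ δ, likelihood A Z₀ B
          ∂connectivityPrior K κ₁ κ₂ := integral_const_mul _ _
      _ ≤ _ := by
          refine mul_le_mul_of_nonneg_left (setIntegral_le_integral hi ?_) (sq_nonneg _)
          filter_upwards [ae_connectivityPrior K h₁ h₂] with B hB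
          exact likelihood_nonneg A Z₀ hB
  have hB₀c : IsConnectivity B₀ := fun c => ⟨by linarith [(hBb c).1], by linarith [(hBb c).2]⟩
  have haff : 1 / 2 ≤ affinity p q := by
    have := le_affinity_of_le hqp (by linarith : p ≤ 1); linarith
  calc _ ≤ ∑ A : SimpleGraph (Fin n), likelihood A Z₀ B₀ * g A :=
        Finset.sum_le_sum fun A _ =>
          mul_le_mul_of_nonneg_left (hterm A) (likelihood_nonneg A Z₀ hB₀c)
    _ = ∑ A : SimpleGraph (Fin n), ∏ e ∈ nodePairs n,
          if A.Adj e.1 e.2 then P e * ξ e else (1 - P e) * υ e := by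
        refine Finset.sum_congr rfl fun A _ => ?_
        rw [likelihood_eq, hg, ← Finset.prod_mul_distrib]
        refine Finset.prod_congr rfl fun e _ => ?_
        split_ifs <;> rfl
    _ = ∏ e ∈ nodePairs n, (P e * ξ e + (1 - P e) * υ e) :=
        sum_graph_prod (fun e => P e * ξ e) (fun e => (1 - P e) * υ e)
    _ ≤ ∏ e ∈ nodePairs n, Real.exp ((if tch e then 12 * δ * p else 0) -
          (if ¬(Z₀ e.1 = Z₀ e.2 ↔ Z e.1 = Z e.2) then renyi p q / 2 else 0)) := by
        refine Finset.prod_le_prod (fun e _ => ?_) fun e _ => ?_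
        · have := hPb e
          exact add_nonneg (mul_nonneg (by linarith) (hξ0 e)) (mul_nonneg (by linarith) (hυ0 e))
        · have hPe := hPb e
          have hQe := hQb e
          by_cases ht : tch e
          · have hPp : 0 < √(P e) := Real.sqrt_pos.2 (by linarith)
            have hPp' : 0 < √(1 - P e) := Real.sqrt_pos.2 (by linarith)
            have e1 : P e * ξ e = √(P e * Q e) * (1 + 2 * δ) := by
              simp only [hξ, if_pos ht]
              rw [Real.sqrt_mul (by linarith)]
              nth_rewrite 1 [← Real.mul_self_sqrt (show 0 ≤ P e by linarith)]
              field_simp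
            have e2 : (1 - P e) * υ e = √((1 - P e) * (1 - Q e)) * (1 + 4 * δ * p) := by
              simp only [hυ, if_pos ht]
              rw [Real.sqrt_mul (by linarith)]
              nth_rewrite 1 [← Real.mul_self_sqrt (show 0 ≤ 1 - P e by linarith)]
              field_simp
            have e3 : √(P e * Q e) ≤ p := Real.sqrt_le_iff.2 ⟨hp0.le, by nlinarith⟩
            have e4 : √((1 - P e) * (1 - Q e)) ≤ 1 :=
              Real.sqrt_le_iff.2 ⟨by norm_num, by nlinarith⟩
            -- Edges contribute 2δp and non-edges 4δp. For flipped pairs the affinity is at least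
            -- 1/2, so this is a relative error of at most 12δp.
            have e5 : P e * ξ e + (1 - P e) * υ e ≤ affinity (P e) (Q e) + 6 * δ * p := by
              rw [e1, e2]
              unfold affinity
              have := mul_le_mul_of_nonneg_right e3 hδ0
              have := mul_le_mul_of_nonneg_right e4 hu0
              nlinarith
            rw [if_pos ht]
            refine e5.trans ?_
            by_cases hf : ¬(Z₀ e.1 = Z₀ e.2 ↔ Z e.1 = Z e.2)
            · rw [if_pos hf]
              have e6 : affinity (P e) (Q e) = affinity p q := by
                rw [affinity_comm]; exact affinity_homogeneousB_of_flipped hf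
              rw [e6, sub_eq_add_neg, Real.exp_add, exp_neg_half_renyi (by linarith)]
              have e7 := Real.add_one_le_exp (12 * δ * p)
              have e8 := mul_le_mul_of_nonneg_right e7 (by linarith : 0 ≤ affinity p q)
              nlinarith [mul_le_mul_of_nonneg_left haff (show 0 ≤ 12 * δ * p by positivity)]
            · rw [if_neg hf]
              have e6 : affinity (P e) (Q e) = 1 := by
                have : P e = Q e := homogeneousB_of_not_flipped (not_not.1 hf)
                rw [this, affinity_self (by linarith) (by linarith)]
              rw [e6]
              have e7 := Real.add_one_le_exp (12 * δ * p - 0)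
              have : 0 ≤ δ * p := by positivity
              linarith
          · have hnf : (Z₀ e.1 = Z₀ e.2 ↔ Z e.1 = Z e.2) := by
              simp only [htch, not_or, not_not] at ht
              rw [ht.1, ht.2]
            have e1 : ξ e = 1 := by simp only [hξ, if_neg ht]
            have e2 : υ e = 1 := by simp only [hυ, if_neg ht]
            rw [e1, e2, if_neg ht, if_neg (not_not.2 hnf)]
            simp
    _ = _ := by
        rw [← Real.exp_sum, Finset.sum_sub_distrib, ← Finset.sum_filter, ← Finset.sum_filter,
          Finset.sum_const, Finset.sum_const, nsmul_eq_mul, nsmul_eq_mul, touchedPairs,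
          flippedPairs, mul_comm, mul_comm (renyi p q / 2)]

/-! ### Reduction to posterior odds -/

/-- The expected root of the posterior odds of `Z` against the true labels `Z₀`. -/
def rootOdds {n K : ℕ} (κ₁ κ₂ p q : ℝ) (Z₀ Z : Fin n → Fin K) : ℝ :=
  ∑ A : SimpleGraph (Fin n), likelihood A Z₀ (homogeneousB K p q) *
    √(marginalLikelihood κ₁ κ₂ A Z / marginalLikelihood κ₁ κ₂ A Z₀)

theorem rootOdds_nonneg {n K : ℕ} (κ₁ κ₂ : ℝ) {p q : ℝ} (hq : 0 ≤ q) (hqp : q ≤ p) (hp : p ≤ 1)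
    (Z₀ Z : Fin n → Fin K) : 0 ≤ rootOdds κ₁ κ₂ p q Z₀ Z :=
  Finset.sum_nonneg fun A _ => mul_nonneg
    (likelihood_nonneg A Z₀ (isConnectivity_homogeneousB hq hqp hp)) (Real.sqrt_nonneg _)

theorem rootOdds_perm_comp {n K : ℕ} {κ₁ κ₂ : ℝ} (h₁ : 0 < κ₁) (h₂ : 0 < κ₂) (p q : ℝ)
    (Z₀ Z : Fin n → Fin K) (σ : Equiv.Perm (Fin K)) :
    rootOdds κ₁ κ₂ p q Z₀ (σ ∘ Z) = rootOdds κ₁ κ₂ p q Z₀ Z := by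
  unfold rootOdds
  simp only [marginalLikelihood_perm_comp h₁ h₂]

/-- A posterior probability is at most 1 and, the prior being uniform, at most the ratio of marginal
likelihoods to that of Z₀. Hence its square is at most this ratio. -/
theorem one_sub_sum_rootOdds_le {n K : ℕ} {α κ₁ κ₂ : ℝ} (h₁ : 0 < κ₁) (h₂ : 0 < κ₂) (hn : 2 ≤ n)
    {p q : ℝ} (hq : 0 ≤ q) (hqp : q ≤ p) (hp : p ≤ 1) {Z₀ : Fin n → Fin K}
    (hZ₀ : Z₀ ∈ balanced n K α) :
    1 - ∑ Z ∈ balanced n K α \ clusteringClass Z₀, rootOdds κ₁ κ₂ p q Z₀ Z ≤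
      expectation Z₀ p q fun A => posteriorMass α κ₁ κ₂ A (clusteringClass Z₀) := by
  have hB₀ := isConnectivity_homogeneousB (K := K) hq hqp hp
  set S := balanced n K α with hS
  have hcard : (0 : ℝ) < S.card := by exact_mod_cast Finset.card_pos.2 ⟨Z₀, hZ₀⟩
  have hpos : ∀ A : SimpleGraph (Fin n), ∀ Z : Fin n → Fin K, 0 < marginalLikelihood κ₁ κ₂ A Z :=
    fun A Z => marginalLikelihood_pos h₁ h₂ hn A Z
  set D : SimpleGraph (Fin n) → ℝ := fun A =>
    ∑ Z' : Fin n → Fin K, labelPrior α Z' * marginalLikelihood κ₁ κ₂ A Z' with hD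
  have hnn : ∀ (A : SimpleGraph (Fin n)) (Z : Fin n → Fin K), 0 ≤ labelPrior α Z * marginalLikelihood κ₁ κ₂ A Z := by
    intro A Z
    unfold labelPrior
    split_ifs
    · exact mul_nonneg (by positivity) (hpos A Z).le
    · simp
  have hprior : ∀ Z ∈ S, labelPrior α Z = (S.card : ℝ)⁻¹ := fun Z hZ => by
    unfold labelPrior; rw [if_pos hZ]
  have hge : ∀ (A : SimpleGraph (Fin n)) (Z : Fin n → Fin K),
      labelPrior α Z * marginalLikelihood κ₁ κ₂ A Z ≤ D A := fun A Z =>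
    Finset.single_le_sum (fun Z' _ => hnn A Z') (Finset.mem_univ Z)
  have hDpos : ∀ A, 0 < D A := fun A => by
    refine lt_of_lt_of_le ?_ (hge A Z₀)
    rw [hprior Z₀ hZ₀]
    exact mul_pos (by positivity) (hpos A Z₀)
  have hpost : ∀ A, ∀ Z ∈ S, posterior α κ₁ κ₂ A Z ≤
      √(marginalLikelihood κ₁ κ₂ A Z / marginalLikelihood κ₁ κ₂ A Z₀) := by
    intro A Z hZ
    have e1 : posterior α κ₁ κ₂ A Z ≤ 1 := by
      unfold posterior; exact (div_le_one (hDpos A)).2 (hge A Z)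
    have e0 : 0 ≤ posterior α κ₁ κ₂ A Z := by
      unfold posterior; exact div_nonneg (hnn A Z) (hDpos A).le
    have e2 : posterior α κ₁ κ₂ A Z ≤
        marginalLikelihood κ₁ κ₂ A Z / marginalLikelihood κ₁ κ₂ A Z₀ := by
      have e3 := hge A Z₀
      unfold posterior
      rw [hprior Z₀ hZ₀] at e3
      rw [hprior Z hZ, div_le_div_iff₀ (hDpos A) (hpos A Z₀)]
      calc _ = marginalLikelihood κ₁ κ₂ A Z *
            ((S.card : ℝ)⁻¹ * marginalLikelihood κ₁ κ₂ A Z₀) := by ring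
        _ ≤ _ := mul_le_mul_of_nonneg_left e3 (hpos A Z).le
    refine Real.le_sqrt_of_sq_le ?_
    nlinarith
  have hmass : ∀ A, 1 - ∑ Z ∈ S \ clusteringClass Z₀,
      √(marginalLikelihood κ₁ κ₂ A Z / marginalLikelihood κ₁ κ₂ A Z₀) ≤
      posteriorMass α κ₁ κ₂ A (clusteringClass Z₀) := by
    intro A
    have htot : ∑ Z : Fin n → Fin K, posterior α κ₁ κ₂ A Z = 1 := by
      unfold posterior
      rw [← Finset.sum_div]
      exact div_self (hDpos A).ne'
    rw [← Finset.sum_add_sum_compl (clusteringClass Z₀)] at htot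
    have hcompl : ∑ Z ∈ (clusteringClass Z₀)ᶜ, posterior α κ₁ κ₂ A Z =
        ∑ Z ∈ S \ clusteringClass Z₀, posterior α κ₁ κ₂ A Z := by
      symm
      refine Finset.sum_subset (fun Z hZ => ?_) fun Z hZ hZ' => ?_
      · exact Finset.mem_compl.2 (Finset.mem_sdiff.1 hZ).2
      · have : Z ∉ S := fun h => hZ' (Finset.mem_sdiff.2 ⟨h, Finset.mem_compl.1 hZ⟩)
        unfold posterior labelPrior
        rw [if_neg this]
        simp
    have hle : ∑ Z ∈ S \ clusteringClass Z₀, posterior α κ₁ κ₂ A Z ≤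
        ∑ Z ∈ S \ clusteringClass Z₀,
          √(marginalLikelihood κ₁ κ₂ A Z / marginalLikelihood κ₁ κ₂ A Z₀) :=
      Finset.sum_le_sum fun Z hZ => hpost A Z (Finset.mem_sdiff.1 hZ).1
    unfold posteriorMass
    linarith
  have hE : ∑ A : SimpleGraph (Fin n), likelihood A Z₀ (homogeneousB K p q) *
      (1 - ∑ Z ∈ S \ clusteringClass Z₀,
        √(marginalLikelihood κ₁ κ₂ A Z / marginalLikelihood κ₁ κ₂ A Z₀)) =
      1 - ∑ Z ∈ S \ clusteringClass Z₀, rootOdds κ₁ κ₂ p q Z₀ Z := by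
    simp only [mul_sub, mul_one, Finset.sum_sub_distrib, sum_likelihood, rootOdds]
    congr 1
    rw [Finset.sum_comm]
    refine Finset.sum_congr rfl fun A _ => ?_
    rw [Finset.mul_sum]
  rw [← hE]
  unfold expectation
  exact Finset.sum_le_sum fun A _ =>
    mul_le_mul_of_nonneg_left (hmass A) (likelihood_nonneg A Z₀ hB₀)

theorem perm_comp_mem_balanced {n K : ℕ} {a : ℝ} {Z : Fin n → Fin K} (hZ : Z ∈ balanced n K a)
    (σ : Equiv.Perm (Fin K)) : σ ∘ Z ∈ balanced n K a := by
  have hb := (Finset.mem_filter.1 hZ).2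
  refine Finset.mem_filter.2 ⟨Finset.mem_univ _, fun k => ?_⟩
  have : communitySize (σ ∘ Z) k = communitySize Z (σ.symm k) := by
    unfold communitySize
    congr 1
    ext i
    simp [Equiv.eq_symm_apply]
  rw [this]
  exact hb _

/-- Label assignments outside the class of `Z₀` that are closest to `Z₀` among their
relabellings. -/
def closestLabels {n K : ℕ} (α : ℝ) (Z₀ : Fin n → Fin K) : Finset (Fin n → Fin K) :=
  {Z ∈ balanced n K α | Z ∉ clusteringClass Z₀ ∧
    ∀ σ : Equiv.Perm (Fin K), hammingDist Z Z₀ ≤ hammingDist (σ ∘ Z) Z₀}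

/-- Every label vector outside the class has a closest relabelling with the same root odds, and each
of these is reached from at most K! vectors. -/
theorem sum_rootOdds_le_closest {n K : ℕ} {α κ₁ κ₂ : ℝ} (h₁ : 0 < κ₁) (h₂ : 0 < κ₂)
    {p q : ℝ} (hq : 0 ≤ q) (hqp : q ≤ p) (hp : p ≤ 1) (Z₀ : Fin n → Fin K) :
    ∑ Z ∈ balanced n K α \ clusteringClass Z₀, rootOdds κ₁ κ₂ p q Z₀ Z ≤
      K.factorial * ∑ Z ∈ closestLabels α Z₀, rootOdds κ₁ κ₂ p q Z₀ Z := by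
  set F : (Fin n → Fin K) → ℝ := fun Z =>
    if Z ∈ closestLabels α Z₀ then rootOdds κ₁ κ₂ p q Z₀ Z else 0 with hF
  have hF0 : ∀ Z, 0 ≤ F Z := fun Z => by
    simp only [hF]; split_ifs
    · exact rootOdds_nonneg κ₁ κ₂ hq hqp hp Z₀ Z
    · exact le_rfl
  have hle : ∀ Z ∈ balanced n K α \ clusteringClass Z₀,
      rootOdds κ₁ κ₂ p q Z₀ Z ≤ ∑ σ : Equiv.Perm (Fin K), F (σ ∘ Z) := by
    intro Z hZ
    obtain ⟨hZb, hZc⟩ := Finset.mem_sdiff.1 hZ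
    obtain ⟨σ, _, hσ⟩ := Finset.exists_min_image (Finset.univ : Finset (Equiv.Perm (Fin K)))
      (fun σ => hammingDist (σ ∘ Z) Z₀) Finset.univ_nonempty
    have hmem : σ ∘ Z ∈ closestLabels α Z₀ := by
      refine Finset.mem_filter.2 ⟨perm_comp_mem_balanced hZb σ, ?_, fun τ => ?_⟩
      · intro h
        obtain ⟨τ, hτ⟩ := (Finset.mem_filter.1 h).2
        refine hZc (Finset.mem_filter.2 ⟨Finset.mem_univ _, σ⁻¹ * τ, ?_⟩)
        funext i
        have := congrFun hτ i
        simp only [Function.comp_apply] at this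
        simp [← this]
      · exact hσ (τ * σ) (Finset.mem_univ _)
    have h := Finset.single_le_sum (f := fun σ : Equiv.Perm (Fin K) => F (σ ∘ Z))
      (fun τ _ => hF0 _) (Finset.mem_univ σ)
    have h' : F (σ ∘ Z) = rootOdds κ₁ κ₂ p q Z₀ Z := by
      simp only [hF, if_pos hmem, rootOdds_perm_comp h₁ h₂]
    rw [← h']
    exact h
  have hswap : ∀ σ : Equiv.Perm (Fin K), ∑ Z : Fin n → Fin K, F (σ ∘ Z) =
      ∑ Z ∈ closestLabels α Z₀, rootOdds κ₁ κ₂ p q Z₀ Z := by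
    intro σ
    calc _ = ∑ Z : Fin n → Fin K, F (((Equiv.refl (Fin n)).arrowCongr σ) Z) := rfl
      _ = ∑ Z : Fin n → Fin K, F Z := Equiv.sum_comp _ F
      _ = _ := by
        simp only [hF]
        rw [← Finset.sum_filter]
        simp
  calc _ ≤ ∑ Z ∈ balanced n K α \ clusteringClass Z₀, ∑ σ : Equiv.Perm (Fin K), F (σ ∘ Z) :=
        Finset.sum_le_sum hle
    _ ≤ ∑ Z : Fin n → Fin K, ∑ σ : Equiv.Perm (Fin K), F (σ ∘ Z) :=
        Finset.sum_le_sum_of_subset_of_nonneg (Finset.subset_univ _) fun Z _ _ =>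
          Finset.sum_nonneg fun σ _ => hF0 _
    _ = ∑ σ : Equiv.Perm (Fin K), ∑ Z : Fin n → Fin K, F (σ ∘ Z) := Finset.sum_comm
    _ = _ := by
        rw [Finset.sum_congr rfl fun σ _ => hswap σ, Finset.sum_const, Finset.card_univ,
          Fintype.card_perm, Fintype.card_fin, nsmul_eq_mul]

/-! ### Sums over label assignments -/

/-- The power factorises over the nodes, and each node contributes at most 1 + Kx. -/
theorem sum_pow_hammingDist_le {n K : ℕ} (Z₀ : Fin n → Fin K) {x : ℝ} (hx : 0 ≤ x) :
    ∑ Z : Fin n → Fin K, x ^ hammingDist Z Z₀ ≤ Real.exp (n * K * x) := by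
  have h1 : ∀ Z : Fin n → Fin K, x ^ hammingDist Z Z₀ =
      ∏ i, (if Z i ≠ Z₀ i then x else 1) := by
    intro Z
    rw [Finset.prod_ite, Finset.prod_const, Finset.prod_const_one, mul_one, hammingDist]
  have h2 : ∑ Z : Fin n → Fin K, ∏ i, (if Z i ≠ Z₀ i then x else 1) =
      ∏ i, ∑ k, (if k ≠ Z₀ i then x else 1) := by
    rw [Finset.prod_univ_sum, Fintype.piFinset_univ]
  have h3 : ∀ i, ∑ k, (if k ≠ Z₀ i then x else 1) ≤ Real.exp (K * x) := by
    intro i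
    have : ∑ k, (if k ≠ Z₀ i then x else 1) ≤ ∑ k : Fin K, (x + if k = Z₀ i then 1 else 0) := by
      refine Finset.sum_le_sum fun k _ => ?_
      by_cases h : k = Z₀ i <;> simp [h, hx]
    refine this.trans ?_
    rw [Finset.sum_add_distrib]
    simp only [Finset.sum_const, Finset.card_univ, Fintype.card_fin, nsmul_eq_mul,
      Finset.sum_ite_eq', Finset.mem_univ, if_true]
    exact Real.add_one_le_exp _
  simp only [h1]
  rw [h2]
  calc _ ≤ ∏ _i : Fin n, Real.exp (K * x) :=
        Finset.prod_le_prod (fun i _ => Finset.sum_nonneg fun k _ => by split_ifs <;> simp [hx])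
          fun i _ => h3 i
    _ = _ := by
        rw [Finset.prod_const, Finset.card_univ, Fintype.card_fin, ← Real.exp_nat_mul]
        ring_nf

/-- Write y as nKy times 1/(nK). The power of nKy ≤ 1 is at most its m-th power on the tail, and the
full sum at 1/(nK) is at most e. -/
theorem sum_pow_hammingDist_tail_le {n K : ℕ} (Z₀ : Fin n → Fin K) {y : ℝ} (hy : 0 ≤ y) (m : ℕ)
    (hn : 0 < n) (hK : 0 < K) (hny : n * K * y ≤ 1) :
    ∑ Z : Fin n → Fin K with m ≤ hammingDist Z Z₀, y ^ hammingDist Z Z₀ ≤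
      Real.exp 1 * (n * K * y) ^ m := by
  have hn' : (0 : ℝ) < n := by exact_mod_cast hn
  have hK' : (0 : ℝ) < K := by exact_mod_cast hK
  set x : ℝ := 1 / (n * K) with hx
  have hx0 : 0 ≤ x := by positivity
  have hyx : y = n * K * y * x := by rw [hx]; field_simp
  have hz : 0 ≤ n * K * y := by positivity
  calc _ ≤ ∑ Z : Fin n → Fin K with m ≤ hammingDist Z Z₀,
        (n * K * y) ^ m * x ^ hammingDist Z Z₀ := by
        refine Finset.sum_le_sum fun Z hZ => ?_
        nth_rewrite 1 [hyx]
        rw [mul_pow]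
        exact mul_le_mul_of_nonneg_right
          (pow_le_pow_of_le_one hz hny (Finset.mem_filter.1 hZ).2) (by positivity)
    _ ≤ ∑ Z : Fin n → Fin K, (n * K * y) ^ m * x ^ hammingDist Z Z₀ :=
        Finset.sum_le_sum_of_subset_of_nonneg (Finset.filter_subset _ _) fun _ _ _ => by positivity
    _ = (n * K * y) ^ m * ∑ Z : Fin n → Fin K, x ^ hammingDist Z Z₀ := by rw [Finset.mul_sum]
    _ ≤ (n * K * y) ^ m * Real.exp (n * K * x) :=
        mul_le_mul_of_nonneg_left (sum_pow_hammingDist_le Z₀ hx0) (by positivity)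
    _ = _ := by
        rw [mul_comm, show (n : ℝ) * K * x = 1 by rw [hx]; field_simp]

/-! ### Bounds for the expected root odds at a fixed sample size -/

theorem renyi_nonneg {p q : ℝ} (hq : 0 ≤ q) (hqp : q ≤ p) (hp : p ≤ 1) : 0 ≤ renyi p q := by
  rw [renyi_eq]
  have := Real.log_nonpos (affinity_nonneg p q)
    (affinity_le_one (by linarith) hp hq (by linarith))
  linarith

theorem renyi_le {p q : ℝ} (hq : 0 ≤ q) (hqp : q ≤ p) (hp : p ≤ 1 / 2) :
    renyi p q ≤ 4 * p := by
  have h1 := le_affinity_of_le hqp (by linarith : p ≤ 1)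
  have h2 : Real.log (1 - p) ≤ Real.log (affinity p q) := Real.log_le_log (by linarith) h1
  have h3 := Real.one_sub_inv_le_log_of_pos (show 0 < 1 - p by linarith)
  have h4 : (1 - p)⁻¹ ≤ 1 + 2 * p := by
    rw [inv_le_iff_one_le_mul₀ (by linarith)]
    nlinarith
  rw [renyi_eq]
  linarith

/-- The affinity is exp(-x) with x = I/2 ≤ 2p ≤ ε, and 1 - exp(-x) ≥ x - x². -/
theorem half_renyi_le_one_sub_affinity {p q ε : ℝ} (hq : 0 ≤ q) (hqp : q ≤ p) (hp : p ≤ 1 / 2)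
    (hpε : 2 * p ≤ ε) : (1 - ε) * (renyi p q / 2) ≤ 1 - affinity p q := by
  have h0 := renyi_nonneg hq hqp (by linarith : p ≤ 1)
  have h1 := renyi_le hq hqp hp
  have haff := le_affinity_of_le hqp (by linarith : p ≤ 1)
  rw [← exp_neg_half_renyi (by linarith : 0 < affinity p q), Real.exp_neg]
  set x := renyi p q / 2 with hx
  have hx0 : 0 ≤ x := by positivity
  have h2 := Real.add_one_le_exp x
  have h3 : (Real.exp x)⁻¹ ≤ (x + 1)⁻¹ := inv_anti₀ (by linarith) h2
  have h4 : (x + 1)⁻¹ ≤ 1 - x + x ^ 2 := by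
    rw [inv_le_iff_one_le_mul₀ (by linarith)]
    nlinarith [pow_nonneg hx0 3]
  have h5 : x * x ≤ ε * x := mul_le_mul_of_nonneg_right (by linarith) hx0
  nlinarith

/-- A block has at least 2bn² - n/2 pairs, of which at most 2rn² ≤ bn²/2 are flipped. -/
theorem card_blockPairs_sdiff_ge {n K : ℕ} {α : ℝ} (hα : 0 < α) {b : ℝ}
    (hb : b = 1 / (4 * (α * K) ^ 2)) (Z₀ : Fin n → Fin K) {Z : Fin n → Fin K}
    (hZ : Z ∈ balanced n K α) {r : ℝ} (hd : (hammingDist Z Z₀ : ℝ) ≤ r * n) (hr : 4 * r ≤ b)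
    (hn : 1 ≤ b * n) (c : Sym2 (Fin K)) :
    ((flippedPairs Z₀ Z).card : ℝ) ≤ 2 * r * n ^ 2 ∧
      b * n ^ 2 ≤ (blockPairs Z c \ flippedPairs Z₀ Z).card := by
  have h1 := card_blockPairs_ge hα hZ c
  have h2 : ((n : ℝ) / (α * K)) ^ 2 = 4 * b * n ^ 2 := by
    rw [hb, div_pow, mul_one_div, ← div_div, div_mul_eq_mul_div]
    congr 1
    ring
  have h3 : ((flippedPairs Z₀ Z).card : ℝ) ≤ 2 * hammingDist Z Z₀ * n := by
    exact_mod_cast (Finset.card_le_card (flippedPairs_subset_touchedPairs Z₀ Z)).trans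
      (card_touchedPairs_le Z₀ Z)
  have h4 : ((flippedPairs Z₀ Z).card : ℝ) ≤ 2 * r * n ^ 2 := by
    have := mul_le_mul_of_nonneg_right hd (Nat.cast_nonneg (α := ℝ) n)
    nlinarith
  have h5 : ((blockPairs Z c).card : ℝ) ≤
      (blockPairs Z c \ flippedPairs Z₀ Z).card + (flippedPairs Z₀ Z).card := by
    have := Finset.card_le_card_sdiff_add_card (t := flippedPairs Z₀ Z) (s := blockPairs Z c)
    exact_mod_cast this
  have h6 : (n : ℝ) ≤ b * n ^ 2 := by
    have := mul_le_mul_of_nonneg_right hn (Nat.cast_nonneg (α := ℝ) n)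
    nlinarith
  have h7 : 4 * r * (n : ℝ) ^ 2 ≤ b * n ^ 2 := mul_le_mul_of_nonneg_right hr (sq_nonneg _)
  refine ⟨h4, ?_⟩
  rw [h2] at h1
  nlinarith

/-- Labels at moderate distance `d` from the truth are at Hellinger distance at least
`(1 - ε) d n̄ I`, whatever the connectivity matrix. -/
theorem le_hellinger_of_close {n K : ℕ} {α β : ℝ} (hα : 0 < α) {b : ℝ}
    (hb : b = 1 / (4 * (α * K) ^ 2)) {Z₀ Z : Fin n → Fin K} (hZ₀ : Z₀ ∈ balanced n K β)
    (hZ : Z ∈ balanced n K α) {r ε : ℝ} (hd : (hammingDist Z Z₀ : ℝ) ≤ r * n)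
    (hr0 : 0 ≤ r) (hε0 : 0 < ε) (hε1 : ε ≤ 1) (hrb : 6 * r ≤ ε * b)
    (hrn : r * n ≤ 2 * ε / 3 * effectiveSize K β n) (hn : 1 ≤ b * n)
    {p q : ℝ} (hq : 0 ≤ q) (hqp : q ≤ p) (hp : p ≤ 1 / 2) (hpε : 2 * p ≤ ε / 3)
    {B : Sym2 (Fin K) → ℝ} (hB : IsConnectivity B) :
    (1 - ε) * (hammingDist Z Z₀ * (effectiveSize K β n * renyi p q)) ≤
      hellinger Z₀ Z (homogeneousB K p q) B := by
  have hb0 : 0 ≤ b := by rw [hb]; positivity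
  have h4r : 4 * r ≤ b := by nlinarith
  have hcard := card_blockPairs_sdiff_ge hα hb Z₀ hZ hd h4r hn
  have hmin : ∀ c, ((blockPairs Z c ∩ flippedPairs Z₀ Z).card : ℝ) ≤
      ε / 3 * (blockPairs Z c \ flippedPairs Z₀ Z).card := by
    intro c
    obtain ⟨h1, h2⟩ := hcard c
    have h3 : ((blockPairs Z c ∩ flippedPairs Z₀ Z).card : ℝ) ≤ (flippedPairs Z₀ Z).card := by
      exact_mod_cast Finset.card_le_card Finset.inter_subset_right
    have h4 : ε / 3 * (b * n ^ 2) ≤ ε / 3 * (blockPairs Z c \ flippedPairs Z₀ Z).card :=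
      mul_le_mul_of_nonneg_left h2 (by positivity)
    have h5 : 6 * r * (n : ℝ) ^ 2 ≤ ε * b * n ^ 2 := mul_le_mul_of_nonneg_right hrb (sq_nonneg _)
    nlinarith
  have hW := card_flippedPairs_mul_le_hellinger Z₀ Z hq hqp (by linarith : p ≤ 1) hB
    (by positivity : 0 < ε / 3) hmin
  have hI := half_renyi_le_one_sub_affinity hq hqp hp hpε
  have hI0 := renyi_nonneg hq hqp (by linarith : p ≤ 1)
  have hF := card_flippedPairs_ge hZ₀ Z
  set N := effectiveSize K β n with hN
  set d : ℝ := (hammingDist Z Z₀ : ℝ) with hdd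
  have hd0 : 0 ≤ d := Nat.cast_nonneg _
  have hN0 : 0 ≤ N := by
    have : 0 ≤ 2 * ε / 3 * N := le_trans (by positivity) hrn
    exact nonneg_of_mul_nonneg_right this (by positivity)
  set H := hellinger Z₀ Z (homogeneousB K p q) B with hH
  have e1 : d * (2 * N * (1 - ε / 3)) ≤ (flippedPairs Z₀ Z).card := by
    refine le_trans (mul_le_mul_of_nonneg_left ?_ hd0) hF
    linarith
  have e2 : d * (2 * N * (1 - ε / 3)) * ((1 - ε / 3) * (renyi p q / 2)) ≤ (1 + ε / 3) * H :=
    (mul_le_mul e1 hI (mul_nonneg (by linarith) (by linarith)) (Nat.cast_nonneg _)).trans hW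
  -- A share ε/3 is lost in each of three places: the flipped pair count, the passage from I/2 to
  -- one minus the affinity, and the triangle inequality. Then (1 - ε/3)² ≥ (1 + ε/3)(1 - ε).
  have e3 : (1 + ε / 3) * ((1 - ε) * (d * (N * renyi p q))) ≤ (1 + ε / 3) * H := by
    refine le_trans ?_ e2
    have h0 : 0 ≤ d * (N * renyi p q) := by positivity
    have : d * (2 * N * (1 - ε / 3)) * ((1 - ε / 3) * (renyi p q / 2)) =
      (1 - ε / 3) ^ 2 * (d * (N * renyi p q)) := by ring
    rw [this, ← mul_assoc]
    refine mul_le_mul_of_nonneg_right ?_ h0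
    nlinarith
  exact le_of_mul_le_mul_left e3 (by linarith)

/-- Labels close to the truth with a connectivity matrix having a misfitting entry. -/
theorem le_hellinger_of_notMem_nhd {n K : ℕ} {α : ℝ} (hα : 0 < α) {b : ℝ}
    (hb : b = 1 / (4 * (α * K) ^ 2)) {Z₀ Z : Fin n → Fin K}
    (hZ : Z ∈ balanced n K α) {r : ℝ} (hd : (hammingDist Z Z₀ : ℝ) ≤ r * n) (hr : 4 * r ≤ b)
    (hn : 1 ≤ b * n) {p q δ : ℝ} (hq : 0 < q) (hqp : q ≤ p) (hp : p ≤ 1) (hδ0 : 0 ≤ δ)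
    (hδ1 : δ ≤ 1) (hδn : 1 / (n : ℝ) ^ 2 ≤ δ * q / 2)
    {B B' : Sym2 (Fin K) → ℝ} (hB : B ∉ connectivityNhd (homogeneousB K p q) δ)
    (hB' : IsConnectivity B') (hBB' : ∀ c, |B' c - B c| ≤ 1 / (n : ℝ) ^ 2) :
    b * n ^ 2 * (δ ^ 2 * q / 72) ≤ hellinger Z₀ Z (homogeneousB K p q) B' := by
  simp only [connectivityNhd, Set.mem_ofPred_eq, not_forall, not_le] at hB
  obtain ⟨c, hc⟩ := hB
  have hge : q ≤ homogeneousB K p q c := by unfold homogeneousB; split_ifs <;> linarith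
  -- By `hδn` the rounding removes at most half of the misfit; δ/2 in place of δ turns 18 into 72.
  have h1 : δ / 2 * homogeneousB K p q c ≤ |B' c - homogeneousB K p q c| := by
    have h2 := abs_sub_le (B c) (B' c) (homogeneousB K p q c)
    rw [abs_sub_comm (B c) (B' c)] at h2
    have h3 := hBB' c
    have h4 := mul_le_mul_of_nonneg_left hge hδ0
    linarith
  refine le_trans ?_ (card_mul_le_hellinger Z₀ Z hq hqp hp hB' (by positivity : 0 ≤ δ / 2)
    (by linarith) h1)
  have h5 := (card_blockPairs_sdiff_ge hα hb Z₀ hZ hd hr hn c).2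
  have h6 := mul_le_mul_of_nonneg_right h5 (show 0 ≤ (δ / 2) ^ 2 * q / 18 by positivity)
  refine le_trans (le_of_eq ?_) h6
  ring

theorem rootOdds_le_add {n K : ℕ} {κ₁ κ₂ : ℝ} (h₁ : 0 < κ₁) (h₂ : 0 < κ₂) {p q : ℝ}
    (hq : 0 ≤ q) (hqp : q ≤ p) (hp : p ≤ 1) (Z₀ Z : Fin n → Fin K)
    {U : Set (Sym2 (Fin K) → ℝ)} (hU : MeasurableSet U) :
    rootOdds κ₁ κ₂ p q Z₀ Z ≤
      ∑ A : SimpleGraph (Fin n), likelihood A Z₀ (homogeneousB K p q) *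
        √((∫ B in U, likelihood A Z B ∂connectivityPrior K κ₁ κ₂) /
          marginalLikelihood κ₁ κ₂ A Z₀) +
      ∑ A : SimpleGraph (Fin n), likelihood A Z₀ (homogeneousB K p q) *
        √((∫ B in Uᶜ, likelihood A Z B ∂connectivityPrior K κ₁ κ₂) /
          marginalLikelihood κ₁ κ₂ A Z₀) := by
  rw [← Finset.sum_add_distrib]
  refine Finset.sum_le_sum fun A _ => ?_
  rw [← mul_add]
  refine mul_le_mul_of_nonneg_left ?_
    (likelihood_nonneg A Z₀ (isConnectivity_homogeneousB hq hqp hp))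
  have hnn : ∀ V : Set (Sym2 (Fin K) → ℝ),
      0 ≤ ∫ B in V, likelihood A Z B ∂connectivityPrior K κ₁ κ₂ := fun V => by
    refine integral_nonneg_of_ae (ae_restrict_of_ae ?_)
    filter_upwards [ae_connectivityPrior K h₁ h₂] with B hB
    exact likelihood_nonneg A Z hB
  have hM := marginalLikelihood_nonneg h₁ h₂ A Z₀
  have hsplit : marginalLikelihood κ₁ κ₂ A Z =
      (∫ B in U, likelihood A Z B ∂connectivityPrior K κ₁ κ₂) +
        ∫ B in Uᶜ, likelihood A Z B ∂connectivityPrior K κ₁ κ₂ :=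
    (integral_add_compl hU (integrable_likelihood h₁ h₂ A Z)).symm
  rw [hsplit, add_div]
  exact sqrt_add_le (div_nonneg (hnn _) hM) (div_nonneg (hnn _) hM)

/-- The bound for the part of `rootOdds` near the truth, in terms of the number of errors. -/
theorem inside_exponent_le {n K : ℕ} {β : ℝ} {Z₀ Z : Fin n → Fin K} (hZ₀ : Z₀ ∈ balanced n K β)
    {p q δ ε : ℝ} (hq : 0 ≤ q) (hqp : q ≤ p) (hp : p ≤ 1) (hδ0 : 0 ≤ δ)
    (hδp : 48 * (δ * p) * n ≤ ε * (effectiveSize K β n * renyi p q))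
    (hd : (hammingDist Z Z₀ : ℝ) ≤ ε * effectiveSize K β n) :
    12 * δ * p * (touchedPairs Z₀ Z).card - renyi p q / 2 * (flippedPairs Z₀ Z).card ≤
      -((1 - ε) * (hammingDist Z Z₀ * (effectiveSize K β n * renyi p q))) := by
  have hI0 := renyi_nonneg hq hqp hp
  have hF := card_flippedPairs_ge hZ₀ Z
  have hT : ((touchedPairs Z₀ Z).card : ℝ) ≤ 2 * hammingDist Z Z₀ * n := by
    exact_mod_cast card_touchedPairs_le Z₀ Z
  set N := effectiveSize K β n with hN
  set d : ℝ := (hammingDist Z Z₀ : ℝ) with hdd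
  have hd0 : 0 ≤ d := Nat.cast_nonneg _
  have hp0 : 0 ≤ p := hq.trans hqp
  -- One half of ε pays for the touched pairs, the other for the subtracted d in the count of
  -- flipped pairs.
  have e1 := mul_le_mul_of_nonneg_left hT (show 0 ≤ 12 * δ * p by positivity)
  have e2 := mul_le_mul_of_nonneg_left hF (show 0 ≤ renyi p q / 2 by positivity)
  have e3 := mul_le_mul_of_nonneg_left hδp (show 0 ≤ d / 2 by positivity)
  have e4 := mul_le_mul_of_nonneg_left hd (show 0 ≤ renyi p q / 2 * d by positivity)
  nlinarith

theorem homogeneousB_mem_Ioo {K : ℕ} {p q : ℝ} (hq : 0 < q) (hqp : q ≤ p) (hp : p ≤ 1 / 2)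
    (c : Sym2 (Fin K)) : 0 < homogeneousB K p q c ∧ homogeneousB K p q c < 1 := by
  unfold homogeneousB
  split_ifs <;> constructor <;> linarith

/-- The Hellinger bound without restriction on the connectivity matrix. -/
theorem rootOdds_le_of_le_hellinger {n K : ℕ} {κ₁ κ₂ C : ℝ} (hC : IsHellingerConstant K κ₁ κ₂ C)
    (hn : 2 ≤ n) {p q : ℝ} (hq : 0 < q) (hqp : q ≤ p) (hp : p ≤ 1 / 2) (Z₀ Z : Fin n → Fin K)
    {D : ℝ} (hD : ∀ B, IsConnectivity B → D ≤ hellinger Z₀ Z (homogeneousB K p q) B) :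
    rootOdds κ₁ κ₂ p q Z₀ Z ≤ Real.exp (C * Real.log n - D) := by
  have h := hC n hn Z₀ Z _ (homogeneousB_mem_Ioo hq hqp hp) Set.univ MeasurableSet.univ D
    fun B _ _ B' hB' _ => hD B' hB'
  simpa [rootOdds, marginalLikelihood] using h

/-- The sharp bound for labels with a bounded number of errors. -/
theorem rootOdds_le_of_near {n K : ℕ} {α β κ₁ κ₂ C : ℝ} (hC : IsHellingerConstant K κ₁ κ₂ C)
    (h₁ : 0 < κ₁) (h₂ : 0 < κ₂) (hn2 : 2 ≤ n) (hα : 0 < α) {b : ℝ}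
    (hb : b = 1 / (4 * (α * K) ^ 2)) {Z₀ Z : Fin n → Fin K} (hZ₀ : Z₀ ∈ balanced n K β)
    (hZ : Z ∈ balanced n K α) {r ε : ℝ} (hd : (hammingDist Z Z₀ : ℝ) ≤ r * n) (hr : 4 * r ≤ b)
    (hε0 : 0 ≤ ε) (hrn : r * n ≤ ε * effectiveSize K β n) (hn : 1 ≤ b * n)
    {p q δ : ℝ} (hq : 0 < q) (hqp : q ≤ p) (hp : p ≤ 1 / 2) (hδ0 : 0 ≤ δ) (hδ1 : δ ≤ 1 / 2)
    (hδn : 1 / (n : ℝ) ^ 2 ≤ δ * q / 2)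
    (hδp : 48 * (δ * p) * n ≤ ε * (effectiveSize K β n * renyi p q)) {m : ℕ}
    (hdm : hammingDist Z Z₀ ≤ m) (hX0 : 0 ≤ effectiveSize K β n * renyi p q)
    (hX : m * (effectiveSize K β n * renyi p q) + C * Real.log n ≤
      b * n ^ 2 * (δ ^ 2 * q / 72)) :
    rootOdds κ₁ κ₂ p q Z₀ Z ≤
      2 * Real.exp (-((1 - ε) * (effectiveSize K β n * renyi p q))) ^ hammingDist Z Z₀ := by
  have hp1 : p ≤ 1 := by linarith
  refine (rootOdds_le_add h₁ h₂ hq.le hqp hp1 Z₀ Z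
    (measurableSet_connectivityNhd (homogeneousB K p q) δ)).trans ?_
  rw [← Real.exp_nat_mul, two_mul]
  refine add_le_add ?_ ?_
  · refine (sum_sqrt_setIntegral_nhd_le h₁ h₂ hn2 Z₀ Z hq hqp hp hδ0 hδ1).trans
      (Real.exp_le_exp.2 ?_)
    refine (inside_exponent_le hZ₀ hq.le hqp hp1 hδ0 hδp (hd.trans hrn)).trans (le_of_eq ?_)
    ring
  -- By `hX` the misfit pays for n^C and still leaves exp(-mX), which suffices since d ≤ m.
  · refine (hC n hn2 Z₀ Z _ (homogeneousB_mem_Ioo hq hqp hp) _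
      (measurableSet_connectivityNhd (homogeneousB K p q) δ).compl
      (b * n ^ 2 * (δ ^ 2 * q / 72)) ?_).trans (Real.exp_le_exp.2 ?_)
    · intro B hB _ B' hB' hBB'
      exact le_hellinger_of_notMem_nhd hα hb hZ hd hr hn hq hqp hp1 hδ0 (by linarith) hδn hB hB' hBB'
    · have hdm' : (hammingDist Z Z₀ : ℝ) ≤ m := by exact_mod_cast hdm
      have e1 := mul_le_mul_of_nonneg_right hdm' hX0
      have e2 : 0 ≤ ε * ((hammingDist Z Z₀ : ℝ) * (effectiveSize K β n * renyi p q)) := by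
        positivity
      nlinarith

theorem one_le_hammingDist_of_mem_closestLabels {n K : ℕ} {α : ℝ} {Z₀ Z : Fin n → Fin K}
    (hZ : Z ∈ closestLabels α Z₀) : 1 ≤ hammingDist Z Z₀ := by
  refine Nat.one_le_iff_ne_zero.2 fun h => ?_
  rw [hammingDist_eq_zero] at h
  exact (Finset.mem_filter.1 hZ).2.1 (Finset.mem_filter.2 ⟨Finset.mem_univ _, 1, h⟩)

/-- Summation over labels with few, moderately many and many errors. -/
theorem sum_closestLabels_le {n K : ℕ} {α : ℝ} (Z₀ : Fin n → Fin K) (hn : 0 < n) (hK : 0 < K)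
    {F : (Fin n → Fin K) → ℝ} {y E G r : ℝ} {m : ℕ} (hy : 0 ≤ y) (hE : 0 ≤ E) (hG : 0 ≤ G)
    (hny : n * K * y ≤ 1)
    (hfew : ∀ Z ∈ closestLabels α Z₀, hammingDist Z Z₀ ≤ m → F Z ≤ 2 * y ^ hammingDist Z Z₀)
    (hmod : ∀ Z ∈ closestLabels α Z₀, (hammingDist Z Z₀ : ℝ) ≤ r → F Z ≤ E * y ^ hammingDist Z Z₀)
    (hmany : ∀ Z ∈ closestLabels α Z₀, r < (hammingDist Z Z₀ : ℝ) → F Z ≤ G) :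
    ∑ Z ∈ closestLabels α Z₀, F Z ≤
      2 * (Real.exp 1 * (n * K * y)) + E * (Real.exp 1 * (n * K * y) ^ m) + (K : ℝ) ^ n * G := by
  have hle : ∀ Z ∈ closestLabels α Z₀, F Z ≤
      2 * (if 1 ≤ hammingDist Z Z₀ then y ^ hammingDist Z Z₀ else 0) +
        E * (if m ≤ hammingDist Z Z₀ then y ^ hammingDist Z Z₀ else 0) + G := by
    intro Z hZ
    rw [if_pos (one_le_hammingDist_of_mem_closestLabels hZ)]
    have h0 : 0 ≤ y ^ hammingDist Z Z₀ := pow_nonneg hy _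
    have h1 : 0 ≤ E * (if m ≤ hammingDist Z Z₀ then y ^ hammingDist Z Z₀ else 0) :=
      mul_nonneg hE (by split_ifs <;> simp [h0])
    by_cases hm : hammingDist Z Z₀ ≤ m
    · linarith [hfew Z hZ hm]
    · rw [if_pos (not_le.1 hm).le] at h1 ⊢
      by_cases hr : (hammingDist Z Z₀ : ℝ) ≤ r
      · linarith [hmod Z hZ hr]
      · linarith [hmany Z hZ (not_le.1 hr)]
  have hpos : ∀ Z : Fin n → Fin K, 0 ≤
      2 * (if 1 ≤ hammingDist Z Z₀ then y ^ hammingDist Z Z₀ else 0) +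
        E * (if m ≤ hammingDist Z Z₀ then y ^ hammingDist Z Z₀ else 0) + G := by
    intro Z
    have h0 : 0 ≤ y ^ hammingDist Z Z₀ := pow_nonneg hy _
    refine add_nonneg (add_nonneg (mul_nonneg (by norm_num) ?_) (mul_nonneg hE ?_)) hG <;>
      split_ifs <;> simp [h0]
  calc _ ≤ ∑ Z : Fin n → Fin K,
        (2 * (if 1 ≤ hammingDist Z Z₀ then y ^ hammingDist Z Z₀ else 0) +
          E * (if m ≤ hammingDist Z Z₀ then y ^ hammingDist Z Z₀ else 0) + G) :=
        (Finset.sum_le_sum hle).trans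
          (Finset.sum_le_sum_of_subset_of_nonneg (Finset.subset_univ _) fun Z _ _ => hpos Z)
    _ = 2 * ∑ Z : Fin n → Fin K with 1 ≤ hammingDist Z Z₀, y ^ hammingDist Z Z₀ +
        E * ∑ Z : Fin n → Fin K with m ≤ hammingDist Z Z₀, y ^ hammingDist Z Z₀ +
        (K : ℝ) ^ n * G := by
        rw [Finset.sum_add_distrib, Finset.sum_add_distrib, ← Finset.mul_sum, ← Finset.mul_sum,
          Finset.sum_filter, Finset.sum_filter]
        simp
    _ ≤ _ := by
        have e1 := sum_pow_hammingDist_tail_le Z₀ hy 1 hn hK hny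
        have e2 := sum_pow_hammingDist_tail_le Z₀ hy m hn hK hny
        rw [pow_one] at e1
        have e3 := mul_le_mul_of_nonneg_left e2 hE
        linarith

/-! ### Asymptotics -/

theorem exists_effectiveSize_eq {K : ℕ} (hK : 2 ≤ K) {β : ℝ} (hβ : 1 ≤ β) :
    ∃ a : ℝ, 0 < a ∧ a ≤ 1 / 2 ∧ ∀ n, effectiveSize K β n = a * n := by
  have hK' : (2 : ℝ) ≤ K := by exact_mod_cast hK
  by_cases h : K = 2
  · exact ⟨1 / 2, by norm_num, le_rfl, fun n => by rw [effectiveSize, if_pos h]; ring⟩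
  · refine ⟨1 / (K * β), by positivity, ?_, fun n => by rw [effectiveSize, if_neg h]; ring⟩
    exact one_div_le_one_div_of_le (by norm_num) (by nlinarith)

theorem balanced_mono {n K : ℕ} {a a' : ℝ} (ha : 0 < a) (h : a ≤ a') :
    balanced n K a ⊆ balanced n K a' := by
  intro Z hZ
  have hb := (Finset.mem_filter.1 hZ).2
  refine Finset.mem_filter.2 ⟨Finset.mem_univ _, fun k => ⟨le_trans ?_ (hb k).1,
    (hb k).2.trans ?_⟩⟩
  · rcases Nat.eq_zero_or_pos K with hK | hK
    · simp [hK]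
    · have : (0 : ℝ) < K := by exact_mod_cast hK
      gcongr
  · gcongr

set_option maxHeartbeats 400000 in
/-- For every `ε₀ > 0` the posterior contraction bound holds eventually with `ε₀` in place of the
vanishing sequence. -/
theorem eventually_le_expectation (K : ℕ) (hK : 2 ≤ K) (α β κ₁ κ₂ : ℝ) (hβ : 1 ≤ β) (hαβ : β < α)
    (hκ₁ : 0 < κ₁) (hκ₂ : 0 < κ₂) (p q : ℕ → ℝ)
    (hqp : ∀ n, q n < p n) (hp0 : Tendsto p atTop (𝓝 0)) {c₀ : ℝ} (hc₀ : 0 < c₀)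
    (hq : ∀ᶠ n in atTop, 0 < q n ∧ p n ≤ c₀ * q n) {γ : ℝ} (hγ : 0 < γ)
    (hX : ∀ᶠ n : ℕ in atTop,
      (1 + γ) * Real.log n ≤ effectiveSize K β n * renyi (p n) (q n)) {ε₀ : ℝ} (hε₀ : 0 < ε₀) :
    ∀ᶠ n : ℕ in atTop, ∀ Zstar ∈ balanced n K β,
      1 - n * Real.exp (-(1 - ε₀) * (effectiveSize K β n * renyi (p n) (q n))) ≤
        expectation Zstar (p n) (q n) fun A =>
          posteriorMass α κ₁ κ₂ A (clusteringClass Zstar) := by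
  obtain ⟨a, ha0, ha1, ha⟩ := exists_effectiveSize_eq hK hβ
  obtain ⟨C, hC0, hC⟩ := exists_isHellingerConstant K hκ₁ hκ₂
  have hα0 : 0 < α := by linarith
  have hβ0 : 0 < β := by linarith
  have hK0 : (0 : ℝ) < K := by exact_mod_cast (by omega : 0 < K)
  -- The second bound gives (1 - ε)(1 + γ) ≥ 1 + ε, hence n exp(-(1 - ε)X) ≤ n^(-ε). The first
  -- allows for losing ε twice.
  set ε : ℝ := min (ε₀ / 2) (γ / (2 + γ)) with hε
  have hεpos : 0 < ε := by positivity
  have hεγ : ε * (2 + γ) ≤ γ := by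
    rw [← le_div_iff₀ (by positivity)]; exact min_le_right _ _
  have hε1 : ε ≤ 1 :=
    (min_le_right _ _).trans ((div_le_one (by positivity)).2 (by linarith))
  have hε2 : 2 * ε ≤ ε₀ := by
    have : ε ≤ ε₀ / 2 := min_le_left _ _
    linarith
  set b : ℝ := 1 / (4 * (α * K) ^ 2) with hb
  have hb0 : 0 < b := by positivity
  set r : ℝ := min (2 * a * ε / 3) (ε * b / 6) with hr
  have hr0 : 0 < r := by positivity
  have hra : r ≤ 2 * a * ε / 3 := min_le_left _ _
  have hrb : 6 * r ≤ ε * b := by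
    have : r ≤ ε * b / 6 := min_le_right _ _
    linarith
  have h4r : 4 * r ≤ b := by
    have := mul_le_mul_of_nonneg_right hε1 hb0.le
    linarith
  -- With δP = ε₁I this turns `hδp` into an equality.
  set ε₁ : ℝ := ε * a / 48 with hε₁
  have hε₁0 : 0 < ε₁ := by positivity
  -- Then (n^(-ε/2))^m₁ ≤ n^(-C). The threshold for few errors is m₁ + 1, so that one factor nKy
  -- survives.
  obtain ⟨m₁, hm₁⟩ := exists_nat_ge (2 * C / ε)
  have hm₁' : C ≤ ε / 2 * m₁ := by
    rw [div_le_iff₀ hεpos] at hm₁; linarith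
  obtain ⟨c, hc0, n₀, hfar⟩ := exists_mul_sq_le_hellinger K (by omega) hα0 hβ0 hr0
  -- For p ≤ w the misfit cost, at least bε₁²X²/(72a²c₀p), exceeds (m₁ + 1 + C)X.
  set w : ℝ := b * ε₁ ^ 2 / ((m₁ + 1 + C) * (72 * a ^ 2 * c₀)) with hw
  have hw0 : 0 < w := by positivity
  set M : ℝ := K.factorial * (3 * (Real.exp 1 * K) + 1) with hM
  have hM0 : 0 < M := by positivity
  have hlog : Tendsto (fun n : ℕ => Real.log n) atTop atTop :=
    Real.tendsto_log_atTop.comp tendsto_natCast_atTop_atTop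
  have hcast : Tendsto (fun n : ℕ => (n : ℝ)) atTop atTop := tendsto_natCast_atTop_atTop
  filter_upwards [hq, hX, eventually_ge_atTop (max 2 n₀), hcast.eventually_ge_atTop (1 / b),
    hcast.eventually_ge_atTop ((m₁ + 1 : ℕ) / r), hcast.eventually_ge_atTop (2 * c₀ * a / ε₁),
    hcast.eventually_ge_atTop (8 * a * (C + 1) / c),
    hp0.eventually_le_const (show (0 : ℝ) < min (1 / 2) (min (ε / 6) w) by positivity),
    hlog.eventually_ge_atTop (max 1 (max (Real.log K / (ε / 2))
      (max (8 * a * Real.log K / c) (Real.log M / ε))))]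
    with n hqn hXn hn hnb hnm hnε hnc hpn hlogn Z₀ hZ₀
  obtain ⟨hq0, hpq⟩ := hqn
  set P := p n with hP
  set Q := q n with hQ
  have hQP : Q ≤ P := (hqp n).le
  have hP2 : P ≤ 1 / 2 := hpn.trans (min_le_left _ _)
  have hPε : 2 * P ≤ ε / 3 := by
    have : P ≤ ε / 6 := hpn.trans ((min_le_right _ _).trans (min_le_left _ _))
    linarith
  have hPw : P ≤ w := hpn.trans ((min_le_right _ _).trans (min_le_right _ _))
  have hP0 : 0 < P := by linarith
  have hP1 : P ≤ 1 := by linarith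
  have hn2 : 2 ≤ n := (le_max_left _ _).trans hn
  have hnn₀ : n₀ ≤ n := (le_max_right _ _).trans hn
  have hn0 : (0 : ℝ) < n := by exact_mod_cast (by omega : 0 < n)
  have hl1 : 1 ≤ Real.log n := (le_max_left _ _).trans hlogn
  have hlK : Real.log K ≤ ε / 2 * Real.log n := by
    have : Real.log K / (ε / 2) ≤ Real.log n :=
      (le_max_left _ _).trans ((le_max_right _ _).trans hlogn)
    rw [div_le_iff₀ (by positivity)] at this
    linarith
  have hlc : 8 * a * Real.log K / c ≤ Real.log n :=
    (le_max_left _ _).trans ((le_max_right _ _).trans ((le_max_right _ _).trans hlogn))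
  have hlM : Real.log M / ε ≤ Real.log n :=
    (le_max_right _ _).trans ((le_max_right _ _).trans ((le_max_right _ _).trans hlogn))
  set I := renyi P Q with hI
  have hI0 : 0 ≤ I := renyi_nonneg hq0.le hQP hP1
  have hI4 : I ≤ 4 * P := renyi_le hq0.le hQP hP2
  set X := effectiveSize K β n * I with hXdef
  have hXa : X = a * n * I := by rw [hXdef, ha]
  have hXl : Real.log n ≤ X := by
    have : 0 ≤ γ * Real.log n := mul_nonneg hγ.le (by linarith)
    linarith
  have hX1 : 1 ≤ X := hl1.trans hXl
  have hbn : 1 ≤ b * n := by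
    rw [div_le_iff₀ hb0] at hnb; linarith
  have hmr : ((m₁ + 1 : ℕ) : ℝ) ≤ r * n := by
    rw [div_le_iff₀ hr0] at hnm; linarith
  have hεX : (1 + ε) * Real.log n ≤ (1 - ε) * X := by
    have h1 : (1 - ε) * ((1 + γ) * Real.log n) ≤ (1 - ε) * X :=
      mul_le_mul_of_nonneg_left hXn (by linarith)
    have h2 : (1 + ε) * Real.log n ≤ (1 - ε) * (1 + γ) * Real.log n :=
      mul_le_mul_of_nonneg_right (by linarith) (by linarith)
    linarith
  set y : ℝ := Real.exp (-((1 - ε) * X)) with hy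
  have hy0 : 0 < y := Real.exp_pos _
  have hexpn : Real.exp (Real.log n) = n := Real.exp_log hn0
  have hnKy : n * K * y ≤ Real.exp (-(ε / 2 * Real.log n)) := by
    rw [hy, ← Real.exp_log hK0, ← hexpn, ← Real.exp_add, ← Real.exp_add]
    refine Real.exp_le_exp.2 ?_
    rw [hexpn]
    linarith
  have hnKy1 : n * K * y ≤ 1 := hnKy.trans (Real.exp_le_one_iff.2 (by
    have : 0 ≤ ε / 2 * Real.log n := by positivity
    linarith))
  have hrN : r * n ≤ 2 * ε / 3 * effectiveSize K β n := by
    rw [ha]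
    have := mul_le_mul_of_nonneg_right hra hn0.le
    linarith
  have hN0 : 0 ≤ effectiveSize K β n := by rw [ha]; positivity
  -- the radius of the neighbourhood of the true connectivity matrix
  set δ : ℝ := ε₁ * I / P with hδ
  have hδ0 : 0 ≤ δ := by positivity
  have hδP : δ * P = ε₁ * I := by rw [hδ]; field_simp
  have hδ1 : δ ≤ 1 / 2 := by
    rw [hδ, div_le_iff₀ hP0]
    have : ε₁ ≤ 1 / 8 := by
      have := mul_le_mul hε1 ha1 ha0.le zero_le_one
      linarith
    have := mul_le_mul this hI4 hI0 (by norm_num)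
    linarith
  have hQP' : 1 / c₀ ≤ Q / P := by
    rw [div_le_div_iff₀ hc₀ hP0]; linarith
  have hδn : 1 / (n : ℝ) ^ 2 ≤ δ * Q / 2 := by
    have e1 : δ * Q / 2 = ε₁ * I / 2 * (Q / P) := by rw [hδ]; ring
    have e2 : ε₁ * I / 2 * (1 / c₀) ≤ δ * Q / 2 := by
      rw [e1]; exact mul_le_mul_of_nonneg_left hQP' (by positivity)
    refine le_trans ?_ e2
    rw [div_le_iff₀ hε₁0] at hnε
    rw [mul_one_div, div_div, div_le_div_iff₀ (by positivity) (by positivity)]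
    have e3 : 2 * c₀ * a * 1 ≤ n * ε₁ * X := mul_le_mul hnε hX1 (by norm_num) (by positivity)
    rw [hXa] at e3
    have e4 : a * (1 * (2 * c₀)) ≤ a * (ε₁ * I * n ^ 2) := by linarith
    exact le_of_mul_le_mul_left e4 ha0
  have hδp : 48 * (δ * P) * n ≤ ε * X := by
    rw [hδP, hXa, hε₁]
    exact le_of_eq (by ring)
  have hout : ((m₁ + 1 : ℕ) : ℝ) * X + C * Real.log n ≤ b * n ^ 2 * (δ ^ 2 * Q / 72) := by
    have e1 : b * n ^ 2 * (δ ^ 2 * Q / 72) = b * ε₁ ^ 2 * X ^ 2 / (72 * a ^ 2 * P) * (Q / P) := by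
      rw [hδ, hXa]; field_simp
    have e2 : b * ε₁ ^ 2 * X ^ 2 / (72 * a ^ 2 * P) * (1 / c₀) ≤ b * n ^ 2 * (δ ^ 2 * Q / 72) := by
      rw [e1]; exact mul_le_mul_of_nonneg_left hQP' (by positivity)
    refine le_trans ?_ e2
    rw [mul_one_div, div_div, le_div_iff₀ (by positivity)]
    have e3 : P * ((m₁ + 1 + C) * (72 * a ^ 2 * c₀)) ≤ b * ε₁ ^ 2 := by
      rw [← le_div_iff₀ (by positivity)]; exact hPw
    have e4 : ((m₁ + 1 : ℕ) : ℝ) * X + C * Real.log n ≤ (m₁ + 1 + C) * X := by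
      have := mul_le_mul_of_nonneg_left hXl hC0
      push_cast
      linarith
    calc _ ≤ (m₁ + 1 + C) * X * (72 * a ^ 2 * P * c₀) :=
          mul_le_mul_of_nonneg_right e4 (by positivity)
      _ = P * ((m₁ + 1 + C) * (72 * a ^ 2 * c₀)) * X := by ring
      _ ≤ b * ε₁ ^ 2 * X := mul_le_mul_of_nonneg_right e3 (by linarith)
      _ ≤ b * ε₁ ^ 2 * X ^ 2 :=
          mul_le_mul_of_nonneg_left (le_self_pow₀ hX1 two_ne_zero) (by positivity)
  set E : ℝ := Real.exp (C * Real.log n) with hE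
  set G : ℝ := Real.exp (C * Real.log n - c * n ^ 2 * (1 - affinity P Q)) with hG
  have hsum : ∑ Z ∈ closestLabels α Z₀, rootOdds κ₁ κ₂ P Q Z₀ Z ≤
      2 * (Real.exp 1 * (n * K * y)) + E * (Real.exp 1 * (n * K * y) ^ (m₁ + 1)) +
        (K : ℝ) ^ n * G := by
    refine sum_closestLabels_le (r := r * n) Z₀ (by omega) (by omega) hy0.le (Real.exp_pos _).le
      (Real.exp_pos _).le hnKy1 ?_ ?_ ?_
    · intro Z hZ hd
      have hZb := (Finset.mem_filter.1 hZ).1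
      have hd' : (hammingDist Z Z₀ : ℝ) ≤ r * n :=
        le_trans (by exact_mod_cast hd) hmr
      refine rootOdds_le_of_near hC hκ₁ hκ₂ hn2 hα0 hb hZ₀ hZb hd' h4r hεpos.le ?_ hbn hq0 hQP hP2
        hδ0 hδ1 hδn hδp hd (by linarith) hout
      have := mul_nonneg hεpos.le hN0
      linarith
    · intro Z hZ hd
      have hZb := (Finset.mem_filter.1 hZ).1
      refine (rootOdds_le_of_le_hellinger hC hn2 hq0 hQP hP2 Z₀ Z fun B hB =>
        le_hellinger_of_close hα0 hb hZ₀ hZb hd hr0.le hεpos hε1 hrb hrN hbn hq0.le hQP hP2 hPε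
          hB).trans (le_of_eq ?_)
      rw [hE, hy, ← Real.exp_nat_mul, ← Real.exp_add]
      congr 1
      ring
    · intro Z hZ hd
      obtain ⟨hZb, _, hmin⟩ := Finset.mem_filter.1 hZ
      refine rootOdds_le_of_le_hellinger hC hn2 hq0 hQP hP2 Z₀ Z fun B hB =>
        hfar n hnn₀ Z₀ hZ₀ Z hZb (fun σ => lt_of_lt_of_le hd ?_) P Q hq0.le hQP hP1 B hB
      exact_mod_cast hmin σ
  have hsecond : E * (n * K * y) ^ (m₁ + 1) ≤ n * K * y := by
    rw [pow_succ, ← mul_assoc]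
    refine mul_le_of_le_one_left (by positivity) ?_
    have e1 : (n * K * y) ^ m₁ ≤ Real.exp (-(ε / 2 * Real.log n)) ^ m₁ :=
      pow_le_pow_left₀ (by positivity) hnKy m₁
    refine (mul_le_mul_of_nonneg_left e1 (Real.exp_pos _).le).trans ?_
    rw [← Real.exp_nat_mul, ← Real.exp_add]
    refine Real.exp_le_one_iff.2 ?_
    have := mul_le_mul_of_nonneg_right hm₁' (show 0 ≤ Real.log n by linarith)
    linarith
  -- The distance is at least c nX/(4a). Half of it pays for K^n, the other half for n^C and y.
  have hthird : (K : ℝ) ^ n * G ≤ n * y := by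
    have e0 : (K : ℝ) ^ n = Real.exp (n * Real.log K) := by
      rw [Real.exp_nat_mul, Real.exp_log hK0]
    have ey : n * y = Real.exp (Real.log n + -((1 - ε) * X)) := by
      rw [Real.exp_add, hexpn]
    rw [e0, hG, ey, ← Real.exp_add]
    refine Real.exp_le_exp.2 ?_
    have hh := half_renyi_le_one_sub_affinity hq0.le hQP hP2 hPε
    have hh' : I / 4 ≤ 1 - affinity P Q := by
      refine le_trans ?_ hh
      have := mul_le_mul_of_nonneg_right hε1 hI0
      rw [← hI]
      linarith
    have e1 : c / (4 * a) * (n * X) ≤ c * n ^ 2 * (1 - affinity P Q) := by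
      have : c / (4 * a) * (n * X) = c * n ^ 2 * (I / 4) := by rw [hXa]; field_simp
      rw [this]
      exact mul_le_mul_of_nonneg_left hh' (by positivity)
    have e2 : (C + 1) * X ≤ c / (8 * a) * (n * X) := by
      rw [div_le_iff₀ hc0] at hnc
      have : C + 1 ≤ c / (8 * a) * n := by
        rw [div_mul_eq_mul_div, le_div_iff₀ (by positivity)]; linarith
      have := mul_le_mul_of_nonneg_right this (show 0 ≤ X by linarith)
      linarith
    have e3 : n * Real.log K ≤ c / (8 * a) * (n * X) := by
      rw [div_le_iff₀ hc0] at hlc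
      have : Real.log K ≤ c / (8 * a) * X := by
        rw [div_mul_eq_mul_div, le_div_iff₀ (by positivity)]
        have := mul_le_mul_of_nonneg_right hXl hc0.le
        linarith
      have := mul_le_mul_of_nonneg_left this hn0.le
      linarith
    have e4 : C * Real.log n ≤ C * X := mul_le_mul_of_nonneg_left hXl hC0
    have e5 : c / (4 * a) * (n * X) = c / (8 * a) * (n * X) + c / (8 * a) * (n * X) := by
      field_simp; norm_num
    have e6 : 0 ≤ ε * X := by positivity
    linarith
  have htotal : ∑ Z ∈ balanced n K α \ clusteringClass Z₀, rootOdds κ₁ κ₂ P Q Z₀ Z ≤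
      n * Real.exp (-(1 - ε₀) * X) := by
    have e1 := sum_rootOdds_le_closest (α := α) hκ₁ hκ₂ hq0.le hQP hP1 Z₀
    have e2 : ∑ Z ∈ closestLabels α Z₀, rootOdds κ₁ κ₂ P Q Z₀ Z ≤
        (3 * (Real.exp 1 * K) + 1) * (n * y) := by
      have := mul_le_mul_of_nonneg_left hsecond (Real.exp_pos 1).le
      linarith
    have e3 := mul_le_mul_of_nonneg_left e2 (Nat.cast_nonneg (α := ℝ) K.factorial)
    have e4 : M ≤ Real.exp (ε * X) := by
      rw [← Real.log_le_iff_le_exp hM0]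
      rw [div_le_iff₀ hεpos] at hlM
      have := mul_le_mul_of_nonneg_right hXl hεpos.le
      linarith
    calc _ ≤ _ := e1
      _ ≤ _ := e3
      _ = M * (n * y) := by rw [hM]; ring
      _ ≤ Real.exp (ε * X) * (n * y) := mul_le_mul_of_nonneg_right e4 (by positivity)
      _ = n * Real.exp (-(1 - 2 * ε) * X) := by
          rw [hy, mul_left_comm, ← Real.exp_add]; congr 2; ring
      _ ≤ _ := by
          refine mul_le_mul_of_nonneg_left (Real.exp_le_exp.2 ?_) hn0.le
          have := mul_le_mul_of_nonneg_right hε2 (zero_le_one.trans hX1)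
          linarith
  have := one_sub_sum_rootOdds_le hκ₁ hκ₂ hn2 hq0.le hQP hP1 (balanced_mono hβ0 hαβ.le hZ₀)
  linarith

/-! ### From fixed `ε` to a vanishing sequence -/

/-- A family of eventual properties that are monotone in `ε` holds eventually along some positive
sequence tending to zero. -/
theorem exists_seq_tendsto_zero_of_eventually {P : ℕ → ℝ → Prop}
    (hmono : ∀ n ε ε', ε ≤ ε' → P n ε → P n ε') (h : ∀ ε > 0, ∀ᶠ n in atTop, P n ε) :
    ∃ η : ℕ → ℝ, (∀ n, 0 < η n) ∧ Tendsto η atTop (𝓝 0) ∧ ∀ᶠ n in atTop, P n (η n) := by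
  have hbdd : ∀ n, BddBelow {ε : ℝ | 0 < ε ∧ P n ε} := fun n => ⟨0, fun ε hε => hε.1.le⟩
  have hnn : ∀ n, 0 ≤ sInf {ε : ℝ | 0 < ε ∧ P n ε} := fun n => Real.sInf_nonneg fun ε hε => hε.1.le
  -- The infimum need not be attained or positive; the added 1/(n + 1) puts an admissible ε below
  -- the sequence and keeps it positive.
  refine ⟨fun n => sInf {ε : ℝ | 0 < ε ∧ P n ε} + 1 / ((n : ℝ) + 1), fun n => ?_, ?_, ?_⟩
  · have := hnn n
    positivity
  · have h1 : Tendsto (fun n => sInf {ε : ℝ | 0 < ε ∧ P n ε}) atTop (𝓝 0) := by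
      rw [Metric.tendsto_atTop']
      intro ε hε
      obtain ⟨N, hN⟩ := eventually_atTop.1 (h (ε / 2) (by positivity))
      refine ⟨N, fun n hn => ?_⟩
      rw [Real.dist_eq, sub_zero, abs_of_nonneg (hnn n)]
      have : sInf {ε : ℝ | 0 < ε ∧ P n ε} ≤ ε / 2 :=
        csInf_le (hbdd n) ⟨by positivity, hN n hn.le⟩
      linarith
    simpa using h1.add tendsto_one_div_add_atTop_nhds_zero_nat
  · filter_upwards [h 1 one_pos] with n hn
    obtain ⟨ε, hε, hlt⟩ := exists_lt_of_csInf_lt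
      (show {ε : ℝ | 0 < ε ∧ P n ε}.Nonempty from ⟨1, one_pos, hn⟩)
      (show sInf {ε : ℝ | 0 < ε ∧ P n ε} < sInf {ε : ℝ | 0 < ε ∧ P n ε} + 1 / ((n : ℝ) + 1) by
        have : 0 < 1 / ((n : ℝ) + 1) := by positivity
        linarith)
    exact hmono n ε _ hlt.le hε.2

theorem tendsto_one_sub_mul_exp {X η : ℕ → ℝ} {γ : ℝ} (hγ : 0 < γ)
    (hX : ∀ᶠ n : ℕ in atTop, (1 + γ) * Real.log n ≤ X n) (hη : Tendsto η atTop (𝓝 0)) :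
    Tendsto (fun n : ℕ => 1 - n * Real.exp (-(1 - η n) * X n)) atTop (𝓝 1) := by
  have hlog : Tendsto (fun n : ℕ => Real.log n) atTop atTop :=
    Real.tendsto_log_atTop.comp tendsto_natCast_atTop_atTop
  -- Chosen so that (1 - ρ)(1 + γ) = 1 + γ/2, which leaves n · n^(-1 - γ/2).
  set ρ : ℝ := γ / (2 * (1 + γ)) with hρ
  have hρ0 : 0 < ρ := by positivity
  have hρ1 : (1 - ρ) * (1 + γ) = 1 + γ / 2 := by rw [hρ]; field_simp; ring
  have hlim : Tendsto (fun n : ℕ => Real.exp (-(γ / 2 * Real.log n))) atTop (𝓝 0) :=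
    Real.tendsto_exp_neg_atTop_nhds_zero.comp (hlog.const_mul_atTop (by positivity))
  have hmain : Tendsto (fun n : ℕ => (n : ℝ) * Real.exp (-(1 - η n) * X n)) atTop (𝓝 0) := by
    refine squeeze_zero' (Eventually.of_forall fun n => by positivity) ?_ hlim
    filter_upwards [hX, hη.eventually_le_const hρ0, eventually_ge_atTop 1] with n hXn hηn hn
    have hn0 : (0 : ℝ) < n := by exact_mod_cast hn
    have hl : 0 ≤ Real.log n := Real.log_nonneg (by exact_mod_cast hn)
    nth_rewrite 1 [← Real.exp_log hn0]
    rw [← Real.exp_add]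
    refine Real.exp_le_exp.2 ?_
    have hX0 : 0 ≤ X n := le_trans (by positivity) hXn
    have hρ2 : 0 ≤ 1 - ρ := by nlinarith
    have e1 : (1 - ρ) * X n ≤ (1 - η n) * X n := mul_le_mul_of_nonneg_right (by linarith) hX0
    have e2 := mul_le_mul_of_nonneg_left hXn hρ2
    rw [← mul_assoc, hρ1] at e2
    linarith
  simpa using hmain.const_sub 1

end

end SBM

theorem theorem1 (K : ℕ) (hK : 2 ≤ K) (α β κ₁ κ₂ : ℝ) (hβ : 1 ≤ β) (hαβ : β < α)
    (hκ₁ : 0 < κ₁) (hκ₂ : 0 < κ₂) (p q : ℕ → ℝ)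
    (hq : ∀ n, 0 ≤ q n) (hqp : ∀ n, q n < p n) (hp : ∀ n, p n ≤ 1)
    (hp0 : Tendsto p atTop (𝓝 0)) (hpq : p =Θ[atTop] q)
    (hI : 1 < liminf (fun n : ℕ =>
      ((SBM.effectiveSize K β n * SBM.renyi (p n) (q n) / Real.log n : ℝ) : EReal)) atTop) :
    ∃ η : ℕ → ℝ, (∀ n, 0 < η n) ∧ Tendsto η atTop (𝓝 0) ∧
      (∀ᶠ n : ℕ in atTop, ∀ Zstar ∈ SBM.balanced n K β,
        1 - n * Real.exp (-(1 - η n) * (SBM.effectiveSize K β n * SBM.renyi (p n) (q n))) ≤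
          SBM.expectation Zstar (p n) (q n) (fun A =>
            SBM.posteriorMass α κ₁ κ₂ A (SBM.clusteringClass Zstar))) ∧
      Tendsto (fun n : ℕ =>
        1 - n * Real.exp (-(1 - η n) * (SBM.effectiveSize K β n * SBM.renyi (p n) (q n))))
        atTop (𝓝 1) := by
  obtain ⟨c₀, hc₀, hbound⟩ := hpq.1.exists_pos
  -- As p is positive, p = O(q) forces q to be positive eventually.
  have hq' : ∀ᶠ n in atTop, 0 < q n ∧ p n ≤ c₀ * q n := by
    filter_upwards [hbound.bound] with n hn
    have hpn : 0 < p n := (hq n).trans_lt (hqp n)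
    rw [Real.norm_of_nonneg hpn.le, Real.norm_of_nonneg (hq n)] at hn
    exact ⟨pos_of_mul_pos_right (hpn.trans_le hn) hc₀.le, hn⟩
  -- A real x strictly between 1 and the limit inferior supplies the margin γ = x - 1.
  obtain ⟨x, hx1, hx⟩ := EReal.lt_iff_exists_real_btwn.1 hI
  have hx1' : 1 < x := by exact_mod_cast hx1
  have hX : ∀ᶠ n : ℕ in atTop, (1 + (x - 1)) * Real.log n ≤
      SBM.effectiveSize K β n * SBM.renyi (p n) (q n) := by
    filter_upwards [eventually_lt_of_lt_liminf hx, eventually_ge_atTop 2] with n hn hn2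
    have hlog : 0 < Real.log n := Real.log_pos (by exact_mod_cast hn2)
    have hn' : x < SBM.effectiveSize K β n * SBM.renyi (p n) (q n) / Real.log n := by
      exact_mod_cast hn
    rw [lt_div_iff₀ hlog] at hn'
    linarith
  have hsize : ∀ n, 0 ≤ SBM.effectiveSize K β n * SBM.renyi (p n) (q n) := by
    intro n
    obtain ⟨a, ha0, _, ha⟩ := SBM.exists_effectiveSize_eq hK hβ
    rw [ha]
    exact mul_nonneg (by positivity) (SBM.renyi_nonneg (hq n) (hqp n).le (hp n))
  obtain ⟨η, hη0, hη, hev⟩ := SBM.exists_seq_tendsto_zero_of_eventually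
    (P := fun n ε => ∀ Zstar ∈ SBM.balanced n K β,
      1 - n * Real.exp (-(1 - ε) * (SBM.effectiveSize K β n * SBM.renyi (p n) (q n))) ≤
        SBM.expectation Zstar (p n) (q n) (fun A =>
          SBM.posteriorMass α κ₁ κ₂ A (SBM.clusteringClass Zstar)))
    (fun n ε ε' hεε' h Zstar hZ => by
      refine le_trans (sub_le_sub_left (mul_le_mul_of_nonneg_left (Real.exp_le_exp.2 ?_)
        (Nat.cast_nonneg n)) 1) (h Zstar hZ)
      exact mul_le_mul_of_nonneg_right (by linarith) (hsize n))
    (fun ε hε => SBM.eventually_le_expectation K hK α β κ₁ κ₂ hβ hαβ hκ₁ hκ₂ p q hqp hp0 hc₀ hq'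
      (by linarith : 0 < x - 1) hX hε)
  exact ⟨η, hη0, hη, hev, SBM.tendsto_one_sub_mul_exp (by linarith : 0 < x - 1) hX hη⟩
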